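/- Let $\mathbb T=\mathbb R\cup\{-\infty\}$ be the max-plus semiring, $b\ge 2$ an integer, and let $P=\operatorname{tconv}(V)=\{\max_{v\in V}(\lambda_v+v):\lambda_v\in\mathbb T,\ \max_{v\in V}\lambda_v=0\}\subseteq\mathbb T^d$ (maxima taken coordinatewise) be a tropical lattice polytope, where $V\subseteq\mathbb Z_{\ge 0}^d$ is finite. Let $\Gamma_b^d=(\log_b \mathbb Z_{\ge0})^d\subseteq\mathbb T^d$ (with $\log_b 0=-\infty$) and $k\odot P=k\mathbf 1+P$. The tropical Ehrhart coefficients $c_0^b(P),\dots,c_d^b(P)\in\mathbb R$ are defined by $$\#\big((k\odot P)\cap\Gamma_b^d\big)=\sum_{i=0}^d c_i^b(P)\,(b^k)^i\qquad\text{for all } k\in\mathbb Z_{\ge 0}.$$ For $\pi\in S_d$, $s=(\prec_1,\dots,\prec_{d+1})\in\{=,<\}^{d+1}$ and $a\in\mathbb Z^d$ let $$\Delta_\pi^s(\mathbf 0)=\{x\in\mathbb R^d:0\prec_{d+1}x_{\pi(d)}\prec_d\cdots\prec_2x_{\pi(1)}\prec_1 1\},\qquad \Delta_\pi^s(a)=a+\Delta_\pi^s(\mathbf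 0).$$ With $x_0=v_0=0$, the covector of $x\in\mathbb R^d$ is $\{(v,k)\in V\times\{0,\dots,d\}: x_k-v_k=\min_{0\le l\le d}(x_l-v_l)\}$; the cells of the covector decomposition of $P$ are the sets of all points of $\mathbb R^d$ with the same covector as some given point of $P$. The alcoved triangulation $\mathcal T_P$ is the set of all nonempty relatively open alcoved simplices $\Delta_\pi^s(a)$ that are contained in a cell of the covector decomposition of $P$. For a lattice polytope $Q\subseteq\mathbb R^d$ let $c_i(Q)$ be its classical Ehrhart coefficients, given by $\#(tQ\cap\mathbb Z^d)=\sum_{i\ge0} c_i(Q)t^i$ for all integers $t\ge1$, and let $D_b^a=\operatorname{diag}(b^{a_1},\dots,b^{a_d})$. Then the tropical Ehrhart coefficients of $P$ exist, $\mathcal T_P$ is finite, each of its elements can be written as $\Delta_\pi^s(a)$ with $a\in\mathbb Z_{\ge 0}^d$, for each such representation $D_b^a\overline{\Delta_\pi^s(\mathbf 0)}$ has an Ehrhart polynomial, and for every $i\in\{0,\dots,d\}$ $$c_i^b(P)=\sum_{\substack{\Delta_\pi^s(a)\in\mathcal T_P\\ m=\dim\Delta_\pi^s(a)\ge i}}(-1)^{m-i}(b-1)^i\,c_i\big(D_b^a\,\overline{\Delta_\pi^s(\mathbf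 0)}\big),$$ where each simplex in $\mathcal T_P$ is counted once and is represented by an arbitrary triple $(\pi,s,a)$ with $a\in\mathbb Z_{\ge0}^d$, and $\overline{\,\cdot\,}$ denotes closure. -/

import Mathlib

noncomputable section

namespace TropEhr

/-! ## Tropical polytopes

The max-plus semiring `𝕋 = ℝ ∪ {-∞}` is `WithBot ℝ`: tropical addition is the maximum (`⊔`),
tropical multiplication is the usual `+`, with `⊥ = -∞`. -/

/-- The inclusion `ℝ^d ⊆ 𝕋^d`. -/
def toTrop {d : ℕ} (x : Fin d → ℝ) : Fin d → WithBot ℝ := fun j => (x j : WithBot ℝ)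

/-- The tropical convex hull of a finite set `V ⊆ 𝕋^d`: all `⨁ λ_v ⊙ v` with `⨁ λ_v = 0`. -/
def tconv {d : ℕ} (V : Finset (Fin d → WithBot ℝ)) : Set (Fin d → WithBot ℝ) :=
  {x | ∃ c : (Fin d → WithBot ℝ) → WithBot ℝ,
    V.sup c = 0 ∧ ∀ j, x j = V.sup (fun v => c v + v j)}

/-- The points of `(ℤ_{≥0} ∪ {-∞})^d`. -/
def tropNat (d : ℕ) : Set (Fin d → WithBot ℝ) :=
  {x | ∀ j, x j = ⊥ ∨ ∃ n : ℕ, x j = ((n : ℝ) : WithBot ℝ)}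

/-! ## The tropical lattice and the tropical Ehrhart polynomial -/

/-- `log_b n` as an element of `𝕋`, with `log_b 0 = -∞`. -/
def tropLog (b n : ℕ) : WithBot ℝ :=
  if n = 0 then ⊥ else ((Real.logb (b : ℝ) (n : ℝ) : ℝ) : WithBot ℝ)

/-- The tropical `b`-lattice `Γ_b^d = (log_b ℤ_{≥0})^d ⊆ 𝕋^d`. -/
def tropLattice (b d : ℕ) : Set (Fin d → WithBot ℝ) :=
  {x | ∀ j, ∃ n : ℕ, x j = tropLog b n}

/-- The tropical dilate `k ⊙ P`. -/
def tropDilate {d : ℕ} (k : ℕ) (P : Set (Fin d → WithBot ℝ)) : Set (Fin d → WithBot ℝ) :=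
  (fun x j => ((k : ℝ) : WithBot ℝ) + x j) '' P

/-- `p` is a tropical Ehrhart polynomial of `P`: it has degree at most `d`, and for all integers
`k ≥ 0` the set `(k ⊙ P) ∩ Γ_b^d` is finite with exactly `p (b ^ k)` elements. -/
def IsTropEhrhartPolynomial {d : ℕ} (b : ℕ) (P : Set (Fin d → WithBot ℝ))
    (p : Polynomial ℝ) : Prop :=
  p.natDegree ≤ d ∧ ∀ k : ℕ, (tropDilate k P ∩ tropLattice b d).Finite ∧
    ((tropDilate k P ∩ tropLattice b d).ncard : ℝ) = p.eval ((b : ℝ) ^ k)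

open Classical in
/-- The tropical Ehrhart coefficient `c_i^b(P)` (for `b ≥ 2` there is at most one tropical Ehrhart
polynomial; the value is `0` if there is none). -/
def tropEhrhartCoeff {d : ℕ} (b : ℕ) (P : Set (Fin d → WithBot ℝ)) (i : ℕ) : ℝ :=
  if h : ∃ p, IsTropEhrhartPolynomial b P p then h.choose.coeff i else 0

/-! ## Classical Ehrhart polynomials -/

/-- The integer lattice `ℤ^d ⊆ ℝ^d`. -/
def intLattice (d : ℕ) : Set (Fin d → ℝ) := {x | ∀ j, ∃ n : ℤ, x j = (n : ℝ)}

/-- `p` is an Ehrhart polynomial of `Q ⊆ ℝ^d`: for all integers `t ≥ 1` the set `tQ ∩ ℤ^d` is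
finite with exactly `p t` elements. -/
def IsEhrhartPolynomial {d : ℕ} (Q : Set (Fin d → ℝ)) (p : Polynomial ℝ) : Prop :=
  ∀ t : ℕ, 0 < t → (((fun x : Fin d → ℝ => (t : ℝ) • x) '' Q) ∩ intLattice d).Finite ∧
    ((((fun x : Fin d → ℝ => (t : ℝ) • x) '' Q) ∩ intLattice d).ncard : ℝ) = p.eval (t : ℝ)

open Classical in
/-- The classical Ehrhart coefficient `c_i(Q)` (there is at most one Ehrhart polynomial; the value
is `0` if there is none). -/
def ehrhartCoeff {d : ℕ} (Q : Set (Fin d → ℝ)) (i : ℕ) : ℝ :=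
  if h : ∃ p, IsEhrhartPolynomial Q p then h.choose.coeff i else 0

/-! ## Alcoved simplices -/

/-- The three relation symbols `=`, `≤`, `<`. -/
inductive RelSymbol
  | eq
  | le
  | lt

/-- The relation on `ℝ` denoted by a relation symbol. -/
def RelSymbol.Holds : RelSymbol → ℝ → ℝ → Prop
  | .eq, x, y => x = y
  | .le, x, y => x ≤ y
  | .lt, x, y => x < y

/-- The sequence `1, x_{π(1)}, …, x_{π(d)}, 0`. -/
def chain {d : ℕ} (π : Equiv.Perm (Fin d)) (x : Fin d → ℝ) : Fin (d + 2) → ℝ :=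
  Fin.cons (α := fun _ => ℝ) 1 (Fin.snoc (α := fun _ => ℝ) (fun j => x (π j)) 0)

/-- `Δ_π^s(0) = {x : 0 ≺_{d+1} x_{π(d)} ≺_d … ≺_2 x_{π(1)} ≺_1 1}`, where `s = (≺_1, …, ≺_{d+1})`. -/
def alcove0 {d : ℕ} (π : Equiv.Perm (Fin d)) (s : Fin (d + 1) → RelSymbol) : Set (Fin d → ℝ) :=
  {x | ∀ j : Fin (d + 1), (s j).Holds (chain π x j.succ) (chain π x j.castSucc)}

/-- `Δ_π^s(a) = a + Δ_π^s(0)`, for `a ∈ ℤ^d`. -/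
def alcove {d : ℕ} (π : Equiv.Perm (Fin d)) (s : Fin (d + 1) → RelSymbol) (a : Fin d → ℤ) :
    Set (Fin d → ℝ) :=
  (fun x j => (a j : ℝ) + x j) '' alcove0 π s

/-- `σ = Δ_π^s(a)` with `s ∈ {=, <}^{d+1}`, so that the simplex is relatively open. -/
def IsRelOpenAlcove {d : ℕ} (σ : Set (Fin d → ℝ)) (π : Equiv.Perm (Fin d))
    (s : Fin (d + 1) → RelSymbol) (a : Fin d → ℤ) : Prop :=
  (∀ j, s j ≠ RelSymbol.le) ∧ σ = alcove π s a

/-- The dimension of (the affine hull of) a nonempty set `σ ⊆ ℝ^d`. -/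
def affDim {d : ℕ} (σ : Set (Fin d → ℝ)) : ℕ := Module.finrank ℝ (vectorSpan ℝ σ)

/-- The image `D_b^a Q` of `Q ⊆ ℝ^d` under the diagonal matrix `D_b^a = diag(b^{a_1}, …, b^{a_d})`. -/
def diagImage {d : ℕ} (b : ℕ) (a : Fin d → ℤ) (Q : Set (Fin d → ℝ)) : Set (Fin d → ℝ) :=
  (fun x => (Matrix.diagonal (fun j => (b : ℝ) ^ (a j))).mulVec x) '' Q

/-! ## Covector decomposition and alcoved triangulation -/

/-- Homogenization: a coordinate `0` with value `0` is put in front. -/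
def homog {d : ℕ} (x : Fin d → WithBot ℝ) : Fin (d + 1) → WithBot ℝ :=
  Fin.cons (α := fun _ => WithBot ℝ) 0 x

/-- The covector (or type) of `x ∈ ℝ^d` with respect to `V`: the pairs `(v, k)` with `v ∈ V` and
`k ∈ {0, …, d}` for which `x_k - v_k = min_l (x_l - v_l)`, where `x_0 = v_0 = 0`. The inequality
`x_k - v_k ≤ x_l - v_l` is written without subtraction. -/
def covector {d : ℕ} (V : Finset (Fin d → WithBot ℝ)) (x : Fin d → ℝ) :
    Set ((Fin d → WithBot ℝ) × Fin (d + 1)) :=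
  {q | q.1 ∈ V ∧ ∀ l : Fin (d + 1),
    homog (toTrop x) q.2 + homog q.1 l ≤ homog (toTrop x) l + homog q.1 q.2}

/-- The covector decomposition of `tconv V` (for `V` with finite coordinates): its relatively open
cells are the sets of points of equal covector that meet `tconv V`. -/
def covectorDecomposition {d : ℕ} (V : Finset (Fin d → WithBot ℝ)) : Set (Set (Fin d → ℝ)) :=
  {F | ∃ x : Fin d → ℝ, toTrop x ∈ tconv V ∧ F = {y | covector V y = covector V x}}

/-- The alcoved triangulation of `tconv V` (for `V` with integer coordinates): the nonempty relatively
open alcoved simplices `Δ_π^s(a)`, `a ∈ ℤ^d`, into which the cells of the covector decomposition are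
subdivided. Its elements are sets, so each simplex occurs once although it may be
written as `Δ_π^s(a)` in several ways. -/
def alcovedTriangulation {d : ℕ} (V : Finset (Fin d → WithBot ℝ)) : Set (Set (Fin d → ℝ)) :=
  {σ | σ.Nonempty ∧ (∃ π s a, IsRelOpenAlcove σ π s a) ∧ ∃ F ∈ covectorDecomposition V, σ ⊆ F}

end TropEhr

end

/-! ## Lattice points of dilated simplices in barycentric coordinates -/

namespace TropEhr

open Finset Polynomial

/-! The relatively open alcoved simplices partition the polytope, so it suffices to count tropical
lattice points in the dilates of one simplex and to add up. Generators with integer coordinates make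
the covector of a point, and with it membership in the polytope, depend only on which inequalities
`x_i - x_j ≤ n` with `n ∈ ℤ` hold (`mem_covector_iff`, `mem_tconv_iff_covector`). The classes of
points satisfying the same such inequalities are exactly the relatively open alcoved simplices
(`alcove_eq_alcoveClass`, `exists_mem_alcove_floor`).

On a simplex with corner `a ≥ 0`, the increasing map `u ↦ b^k (b^u - 1)`, applied to each coordinate
of `x - a`, fixes `0` and sends `1` to `t = (b-1) b^k`. It therefore carries the open unit simplex
onto its `t`-th dilate, without changing `π` and `s`. Since `b^a` times the image differs from
`b^(k+x)` by an integer vector, tropical lattice points become lattice points of the `t`-th dilate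
of the open simplex scaled by `D_b^a` (`image_tropPoints_alcove`).

Ehrhart reciprocity expresses this number as `(-1)^m p(-(b-1) b^k)`, where `p` is the Ehrhart
polynomial of the closed simplex and `m` its dimension. It is proved in
`exists_polynomial_card_simplex` by writing each cone point as an integer part plus a point of the
half-open box; for the open cone the box point is subtracted instead. Summing over the simplices
gives a polynomial in `b^k`, and comparing coefficients gives the formula, with `(-1)^m (-1)^i =
(-1)^(m-i)`. -/

/-- Stars and bars for functions supported on a finite set. -/
lemma card_piAntidiag_nat {ι : Type*} [DecidableEq ι] (J : Finset ι) (m n : ℕ)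
    (hJ : #J = m + 1) : #(piAntidiag J n) = (n + m).choose m := by
  have h1 : #(piAntidiag J n) = #(finsuppAntidiag J n) := by
    simp [finsuppAntidiag]
  rw [h1, card_finsuppAntidiag_nat_eq_choose, hJ]
  rw [← Nat.choose_symm_of_eq_add (by omega : m + 1 + n - 1 = m + n)]
  congr 1; omega

/-- The polynomial `t ↦ binom(t - h + m, m)`. -/
noncomputable def shiftedBinomial (m h : ℕ) : ℝ[X] :=
  C ((m.factorial : ℝ)⁻¹) * (descPochhammer ℝ m).comp (X + C ((m : ℝ) - h))

lemma natDegree_shiftedBinomial_le (m h : ℕ) : (shiftedBinomial m h).natDegree ≤ m := by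
  refine (natDegree_C_mul_le _ _).trans (natDegree_comp_le.trans ?_)
  rw [descPochhammer_natDegree, natDegree_X_add_C, mul_one]

lemma eval_shiftedBinomial (m h t : ℕ) (hm : h ≤ m) :
    (shiftedBinomial m h).eval (t : ℝ) = ((t + m - h).choose m : ℕ) := by
  have h1 : (t : ℝ) + (m - h) = ((t + m - h : ℕ) : ℝ) := by
    rw [Nat.cast_sub (by omega)]; push_cast; ring
  rw [shiftedBinomial]
  simp only [eval_mul, eval_C, eval_comp, eval_add, eval_X]
  rw [h1, descPochhammer_eval_eq_descFactorial, Nat.descFactorial_eq_factorial_mul_choose]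
  push_cast
  field_simp

/-- Reciprocity for a single binomial: reversing the order of the `m` factors of the falling
factorial and negating each turns one side into the other. -/
lemma eval_neg_shiftedBinomial (m h t : ℕ) (ht : 0 < t) :
    (-1) ^ m * (shiftedBinomial m h).eval (-(t : ℝ)) = ((t + h - 1).choose m : ℕ) := by
  have h2 : ((t + h - 1 : ℕ) : ℝ) = t + h - 1 := by
    rw [Nat.cast_sub (by omega)]; push_cast; ring
  have h1 : (-1) ^ m * (descPochhammer ℝ m).eval (-(t : ℝ) + (m - h)) =
      (descPochhammer ℝ m).eval ((t + h - 1 : ℕ) : ℝ) := by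
    rw [descPochhammer_eval_eq_prod_range, descPochhammer_eval_eq_prod_range, h2,
      ← Finset.prod_range_reflect, show (-1 : ℝ) ^ m = ∏ j ∈ range m, (-1 : ℝ) by simp,
      ← Finset.prod_mul_distrib]
    refine Finset.prod_congr rfl fun j hj => ?_
    have hj' := Finset.mem_range.1 hj
    rw [Nat.cast_sub (by omega), Nat.cast_sub (by omega)]
    push_cast; ring
  rw [shiftedBinomial]
  simp only [eval_mul, eval_C, eval_comp, eval_add, eval_X]
  rw [mul_left_comm, h1, descPochhammer_eval_eq_descFactorial,
    Nat.descFactorial_eq_factorial_mul_choose]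
  push_cast
  field_simp

lemma eq_of_mem_Ico_of_sub_eq_int {x y : ℝ} {n : ℤ} (hx : 0 ≤ x ∧ x < 1) (hy : 0 ≤ y ∧ y < 1)
    (h : x - y = n) : x = y := by
  rw [← Int.fract_eq_self.2 hx, ← Int.fract_eq_self.2 hy]
  exact Int.fract_eq_fract.2 ⟨n, h⟩

/-- Ehrhart's theorem with reciprocity for a simplex, in barycentric coordinates: `Λ` is the group of
barycentric coordinates of the lattice points in the cone over the simplex. -/
theorem exists_polynomial_card_simplex {ι : Type*} [Fintype ι] (J : Finset ι) (m : ℕ)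
    (hJ : #J = m + 1) (Λ : AddSubgroup (ι → ℝ))
    (hint : ∀ n : ι → ℤ, (fun i => (n i : ℝ)) ∈ Λ)
    (hsum : ∀ l ∈ Λ, ∃ n : ℤ, ∑ i, l i = n)
    (hfin : {l ∈ (Λ : Set (ι → ℝ)) | ∀ i, 0 ≤ l i ∧ l i < 1}.Finite) :
    ∃ p : ℝ[X], p.natDegree ≤ m ∧
      (∀ t : ℕ, {l ∈ (Λ : Set (ι → ℝ)) |
          (∀ i ∉ J, l i = 0) ∧ (∀ i ∈ J, 0 ≤ l i) ∧ ∑ i, l i = t}.Finite ∧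
        ({l ∈ (Λ : Set (ι → ℝ)) |
          (∀ i ∉ J, l i = 0) ∧ (∀ i ∈ J, 0 ≤ l i) ∧ ∑ i, l i = t}.ncard : ℝ) = p.eval (t : ℝ)) ∧
      (∀ t : ℕ, 0 < t → {l ∈ (Λ : Set (ι → ℝ)) |
          (∀ i ∉ J, l i = 0) ∧ (∀ i ∈ J, 0 < l i) ∧ ∑ i, l i = t}.Finite ∧
        ({l ∈ (Λ : Set (ι → ℝ)) |
          (∀ i ∉ J, l i = 0) ∧ (∀ i ∈ J, 0 < l i) ∧ ∑ i, l i = t}.ncard : ℝ) =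
            (-1) ^ m * p.eval (-(t : ℝ))) := by
  classical
  have sumJ : ∀ {M : Type} [AddCommMonoid M] (f : ι → M), (∀ i ∉ J, f i = 0) →
      ∑ i, f i = ∑ i ∈ J, f i := fun f hf =>
    (Finset.sum_subset (Finset.subset_univ J) (fun i _ hi => hf i hi)).symm
  have hBfin : {l ∈ (Λ : Set (ι → ℝ)) | (∀ i ∉ J, l i = 0) ∧ ∀ i, 0 ≤ l i ∧ l i < 1}.Finite :=
    hfin.subset fun l hl => ⟨hl.1, hl.2.2⟩
  set B : Finset (ι → ℝ) := hBfin.toFinset with hB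
  have memB : ∀ q, q ∈ B ↔ q ∈ Λ ∧ (∀ i ∉ J, q i = 0) ∧ ∀ i, 0 ≤ q i ∧ q i < 1 := by
    intro q; simp [hB]
  -- The height of a box point is an integer below `m + 1`, being a sum of `m + 1` numbers less than
  -- `1`.
  have hht : ∀ q : ι → ℝ, ∃ h : ℕ, q ∈ B → ∑ i, q i = h ∧ h ≤ m := by
    intro q
    by_cases hq : q ∈ B
    · obtain ⟨h1, h2, h3⟩ := (memB q).1 hq
      obtain ⟨n, hn⟩ := hsum q h1
      have hn0 : 0 ≤ n := by
        have : (0 : ℝ) ≤ n := hn ▸ Finset.sum_nonneg fun i _ => (h3 i).1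
        exact_mod_cast this
      lift n to ℕ using hn0
      refine ⟨n, fun _ => ⟨by exact_mod_cast hn, ?_⟩⟩
      have hlt : ∑ i ∈ J, q i < ∑ i ∈ J, (1 : ℝ) :=
        Finset.sum_lt_sum_of_nonempty (Finset.card_pos.1 (by omega)) fun i _ => (h3 i).2
      rw [← sumJ q h2, hn] at hlt
      simp only [Finset.sum_const, hJ, nsmul_eq_mul, mul_one] at hlt
      have : n < m + 1 := by exact_mod_cast hlt
      omega
    · exact ⟨0, fun h => absurd h hq⟩
  choose h hh using hht
  -- both counts are counts of disjoint unions of images of discrete simplices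
  have count : ∀ (S : Set (ι → ℝ)) (A : (ι → ℝ) → Finset (ι → ℕ)) (c : ι → ℝ) (ε : ℝ),
      (ε = 1 ∨ ε = -1) →
      (∀ l, l ∈ S ↔ ∃ q ∈ B, ∃ n ∈ A q, l = fun i => n i + c i + ε * q i) →
      S.Finite ∧ S.ncard = ∑ q ∈ B, #(A q) := by
    intro S A c ε hε hS
    have hS' : S = ((B.biUnion fun q => (A q).image
        fun n => (fun i => (n i : ℝ) + c i + ε * q i : ι → ℝ) : Finset (ι → ℝ)) : Set (ι → ℝ)) := by
      ext l
      rw [hS]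
      simp only [Finset.coe_biUnion, Finset.mem_coe, Set.mem_iUnion, Finset.mem_image, exists_prop,
        eq_comm (a := l)]
    refine ⟨hS' ▸ Finset.finite_toSet _, ?_⟩
    rw [hS', Set.ncard_coe_finset, Finset.card_biUnion]
    · refine Finset.sum_congr rfl fun q _ => Finset.card_image_of_injective _ ?_
      intro n n' hn
      funext i
      have := congrFun hn i
      simp only [add_left_inj, Nat.cast_inj] at this
      exact this
    · intro q hq q' hq' hne
      refine Finset.disjoint_left.2 ?_
      intro l hl hl'
      obtain ⟨n, -, rfl⟩ := Finset.mem_image.1 hl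
      obtain ⟨n', -, hn'⟩ := Finset.mem_image.1 hl'
      apply hne
      funext i
      have hi := congrFun hn' i
      rcases hε with rfl | rfl
      · exact eq_of_mem_Ico_of_sub_eq_int (n := (n' i : ℤ) - n i) (((memB q).1 hq).2.2 i)
          (((memB q').1 hq').2.2 i) (by push_cast; linarith)
      · exact eq_of_mem_Ico_of_sub_eq_int (n := (n i : ℤ) - n' i) (((memB q).1 hq).2.2 i)
          (((memB q').1 hq').2.2 i) (by push_cast; linarith)
  refine ⟨∑ q ∈ B, shiftedBinomial m (h q), natDegree_sum_le_of_forall_le _ _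
    fun q _ => natDegree_shiftedBinomial_le _ _, fun t => ?_, fun t ht => ?_⟩
  -- Closed cone: `l = ⌊l⌋ + fract l`. A box point of height `h` leaves `t - h` to distribute over
  -- `J`.
  · obtain ⟨hf, hc⟩ := count {l ∈ (Λ : Set (ι → ℝ)) |
        (∀ i ∉ J, l i = 0) ∧ (∀ i ∈ J, 0 ≤ l i) ∧ ∑ i, l i = t}
      (fun q => if h q ≤ t then piAntidiag J (t - h q) else ∅) 0 1 (Or.inl rfl) (by
        intro l
        constructor
        · rintro ⟨hl, hl0, hlpos, hlt⟩
          have hnn : ∀ i, 0 ≤ l i := fun i => by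
            by_cases hi : i ∈ J
            · exact hlpos i hi
            · rw [hl0 i hi]
          have hfr : (fun i => Int.fract (l i)) ∈ B := by
            refine (memB _).2 ⟨?_, fun i hi => by simp [hl0 i hi],
              fun i => ⟨Int.fract_nonneg _, Int.fract_lt_one _⟩⟩
            exact Λ.sub_mem hl (hint fun i => ⌊l i⌋)
          have hdec : ∀ i, l i = (⌊l i⌋₊ : ℝ) + Int.fract (l i) := fun i => by
            rw [natCast_floor_eq_intCast_floor (hnn i)]
            exact (Int.floor_add_fract (l i)).symm
          have hs : (t : ℝ) = ((∑ i ∈ J, ⌊l i⌋₊ : ℕ) : ℝ) + (h fun i => Int.fract (l i) : ℕ) := by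
            rw [← hlt, ← (hh _ hfr).1, ← sumJ (fun i => ⌊l i⌋₊) (fun i hi => by simp [hl0 i hi])]
            push_cast
            rw [← Finset.sum_add_distrib]
            exact Finset.sum_congr rfl fun i _ => hdec i
          have hs' : t = ∑ i ∈ J, ⌊l i⌋₊ + (h fun i => Int.fract (l i)) := by exact_mod_cast hs
          refine ⟨_, hfr, fun i => ⌊l i⌋₊, ?_, ?_⟩
          · rw [if_pos (by omega), mem_piAntidiag]
            refine ⟨by omega, fun i hi => ?_⟩
            by_contra hiJ
            exact hi (by simp [hl0 i hiJ])
          · funext i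
            simpa using hdec i
        · rintro ⟨q, hq, n, hn, rfl⟩
          obtain ⟨q1, q2, q3⟩ := (memB q).1 hq
          split_ifs at hn with hle
          · obtain ⟨n1, n2⟩ := mem_piAntidiag.1 hn
            have n3 : ∀ i ∉ J, n i = 0 := fun i hi => by
              by_contra hne
              exact hi (n2 i hne)
            refine ⟨?_, fun i hi => ?_, fun i _ => ?_, ?_⟩
            · have := Λ.add_mem (hint fun i => (n i : ℤ)) q1
              rwa [show (fun i => (n i : ℝ) + (0 : ι → ℝ) i + 1 * q i) =
                (fun i => ((n i : ℤ) : ℝ)) + q from funext fun i => by simp]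
            · simp [n3 i hi, q2 i hi]
            · have := (q3 i).1
              simp only [Pi.zero_apply, add_zero, one_mul]
              positivity
            · simp only [Pi.zero_apply, add_zero, one_mul, Finset.sum_add_distrib, (hh q hq).1]
              rw [← Nat.cast_sum, sumJ n n3, n1, Nat.cast_sub hle]
              ring
          · simp at hn)
    refine ⟨hf, ?_⟩
    rw [hc, eval_finsetSum, Nat.cast_sum]
    refine Finset.sum_congr rfl fun q hq => ?_
    rw [eval_shiftedBinomial _ _ _ (hh q hq).2]
    have := (hh q hq).2
    -- For `t < h` there are no points, and the binomial vanishes too since `t + m - h < m`; this is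
    -- where the polynomial remains valid for small `t`.
    split_ifs with hle
    · rw [card_piAntidiag_nat J m _ hJ]
      congr 2; omega
    · rw [Finset.card_empty, Nat.choose_eq_zero_of_lt (by omega)]
  -- Open cone: `l = ⌈l⌉ - fract (-l)`, and `⌈l⌉ ≥ 1` on `J`. After removing one unit at each of the
  -- `m + 1` indices, `t + h - (m + 1)` is left to distribute.
  · obtain ⟨hf, hc⟩ := count {l ∈ (Λ : Set (ι → ℝ)) |
        (∀ i ∉ J, l i = 0) ∧ (∀ i ∈ J, 0 < l i) ∧ ∑ i, l i = t}
      (fun q => if m + 1 ≤ t + h q then piAntidiag J (t + h q - (m + 1)) else ∅)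
      (fun i => if i ∈ J then 1 else 0) (-1) (Or.inr rfl) (by
        have sum1 : ∑ i, (if i ∈ J then (1 : ℝ) else 0) = m + 1 := by
          simp [hJ]
        intro l
        constructor
        · rintro ⟨hl, hl0, hlpos, hlt⟩
          have hnn : ∀ i, 0 ≤ l i := fun i => by
            by_cases hi : i ∈ J
            · exact (hlpos i hi).le
            · rw [hl0 i hi]
          have hfr : (fun i => Int.fract (-l i)) ∈ B := by
            refine (memB _).2 ⟨?_, fun i hi => by simp [hl0 i hi],
              fun i => ⟨Int.fract_nonneg _, Int.fract_lt_one _⟩⟩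
            exact Λ.sub_mem (Λ.neg_mem hl) (hint fun i => ⌊-l i⌋)
          have hdec : ∀ i, l i = ((⌈l i⌉₊ - 1 : ℕ) : ℝ) + (if i ∈ J then 1 else 0) +
              -1 * Int.fract (-l i) := fun i => by
            by_cases hi : i ∈ J
            · have h1 : 0 < ⌈l i⌉₊ := Nat.ceil_pos.2 (hlpos i hi)
              rw [Nat.cast_sub h1, natCast_ceil_eq_intCast_ceil (hnn i), if_pos hi, Int.fract,
                Int.floor_neg]
              push_cast; ring
            · simp [hl0 i hi, hi]
          have hs : (t : ℝ) + (h fun i => Int.fract (-l i) : ℕ) =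
              ((∑ i ∈ J, (⌈l i⌉₊ - 1) : ℕ) : ℝ) + (m + 1) := by
            rw [← hlt, ← (hh _ hfr).1, ← sum1,
              ← sumJ (fun i => ⌈l i⌉₊ - 1) (fun i hi => by simp [hl0 i hi])]
            push_cast
            rw [← Finset.sum_add_distrib, ← Finset.sum_add_distrib]
            exact Finset.sum_congr rfl fun i _ => by linarith [hdec i]
          have hs' : t + (h fun i => Int.fract (-l i)) = ∑ i ∈ J, (⌈l i⌉₊ - 1) + (m + 1) := by
            exact_mod_cast hs
          refine ⟨_, hfr, fun i => ⌈l i⌉₊ - 1, ?_, ?_⟩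
          · rw [if_pos (by omega), mem_piAntidiag]
            refine ⟨by omega, fun i hi => ?_⟩
            by_contra hiJ
            exact hi (by simp [hl0 i hiJ])
          · funext i
            exact hdec i
        · rintro ⟨q, hq, n, hn, rfl⟩
          obtain ⟨q1, q2, q3⟩ := (memB q).1 hq
          split_ifs at hn with hle
          · obtain ⟨n1, n2⟩ := mem_piAntidiag.1 hn
            have n3 : ∀ i ∉ J, n i = 0 := fun i hi => by
              by_contra hne
              exact hi (n2 i hne)
            refine ⟨?_, fun i hi => ?_, fun i hi => ?_, ?_⟩
            · have := Λ.sub_mem (hint fun i => (n i : ℤ) + if i ∈ J then 1 else 0) q1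
              rwa [show (fun i => (n i : ℝ) + (if i ∈ J then 1 else 0) + -1 * q i) =
                (fun i => (((n i : ℤ) + if i ∈ J then 1 else 0 : ℤ) : ℝ)) - q from
                funext fun i => by simp [sub_eq_add_neg]]
            · simp [n3 i hi, q2 i hi, hi]
            · have := (q3 i).2
              have : (0 : ℝ) ≤ n i := Nat.cast_nonneg _
              simp only [hi, if_true]
              linarith
            · rw [Finset.sum_add_distrib, Finset.sum_add_distrib, sum1, ← Finset.mul_sum,
                (hh q hq).1, ← Nat.cast_sum, sumJ n n3, n1, Nat.cast_sub hle]
              push_cast; ring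
          · simp at hn)
    refine ⟨hf, ?_⟩
    rw [hc, eval_finsetSum, Nat.cast_sum, Finset.mul_sum]
    refine Finset.sum_congr rfl fun q hq => ?_
    rw [eval_neg_shiftedBinomial _ _ _ ht]
    split_ifs with hle
    · rw [card_piAntidiag_nat J m _ hJ]
      congr 2; omega
    · rw [Finset.card_empty, Nat.choose_eq_zero_of_lt (by omega)]

end TropEhr

/-! ## Barycentric coordinates of alcoved simplices -/

namespace TropEhr

open Finset

variable {d : ℕ}

/-- The sequence `t, x_{π(1)}, …, x_{π(d)}, 0`. -/
def dilChain (π : Equiv.Perm (Fin d)) (t : ℝ) (x : Fin d → ℝ) : Fin (d + 2) → ℝ :=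
  Fin.cons (α := fun _ => ℝ) t (Fin.snoc (α := fun _ => ℝ) (fun j => x (π j)) 0)

lemma chain_eq_dilChain (π : Equiv.Perm (Fin d)) (x : Fin d → ℝ) : chain π x = dilChain π 1 x := rfl

@[simp] lemma dilChain_zero (π : Equiv.Perm (Fin d)) (t : ℝ) (x : Fin d → ℝ) :
    dilChain π t x 0 = t := rfl

@[simp] lemma dilChain_last (π : Equiv.Perm (Fin d)) (t : ℝ) (x : Fin d → ℝ) :
    dilChain π t x (Fin.last _) = 0 := by
  rw [← Fin.succ_last, dilChain, Fin.cons_succ, Fin.snoc_last]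

@[simp] lemma dilChain_mid (π : Equiv.Perm (Fin d)) (t : ℝ) (x : Fin d → ℝ) (i : Fin d) :
    dilChain π t x i.castSucc.succ = x (π i) := by
  rw [dilChain, Fin.cons_succ, Fin.snoc_castSucc]

/-- Every index of a sequence `t, x_{π(1)}, …, x_{π(d)}, 0` is the first, the last or one of the
indices in between. -/
lemma chainIndex_cases {P : Fin (d + 2) → Prop} (h0 : P 0) (hl : P (Fin.last _))
    (hm : ∀ i : Fin d, P i.castSucc.succ) (k : Fin (d + 2)) : P k := by
  induction k using Fin.cases with
  | zero => exact h0
  | succ k =>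
    induction k using Fin.lastCases with
    | last => exact hl
    | cast i => exact hm i

/-- The successive differences of a sequence. -/
def gaps {n : ℕ} (c : Fin (n + 1) → ℝ) (j : Fin n) : ℝ := c j.castSucc - c j.succ

/-- The sequence of the tail sums of `l`. -/
def tailSum {n : ℕ} (l : Fin n → ℝ) (k : Fin (n + 1)) : ℝ := ∑ j with k ≤ Fin.castSucc j, l j

lemma tailSum_zero {n : ℕ} (l : Fin n → ℝ) : tailSum l 0 = ∑ j, l j := by
  simp [tailSum]

lemma tailSum_last {n : ℕ} (l : Fin n → ℝ) : tailSum l (Fin.last n) = 0 := by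
  refine Finset.sum_eq_zero fun j hj => ?_
  have := (Finset.mem_filter.1 hj).2
  exact absurd (Fin.castSucc_lt_last j) (not_lt.2 this)

lemma tailSum_castSucc {n : ℕ} (l : Fin n → ℝ) (j : Fin n) :
    tailSum l j.castSucc = l j + tailSum l j.succ := by
  have : ({i | j.castSucc ≤ Fin.castSucc i} : Finset (Fin n)) =
      insert j ({i | j.succ ≤ Fin.castSucc i} : Finset (Fin n)) := by
    ext i
    simp only [Finset.mem_filter, Finset.mem_univ, true_and, Finset.mem_insert, Fin.le_def,
      Fin.ext_iff, Fin.val_castSucc, Fin.val_succ]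
    omega
  rw [tailSum, this, Finset.sum_insert (by simp [Fin.le_def]), tailSum]

lemma gaps_tailSum {n : ℕ} (l : Fin n → ℝ) : gaps (tailSum l) = l := by
  funext j
  rw [gaps, tailSum_castSucc]
  ring

lemma tailSum_gaps {n : ℕ} (c : Fin (n + 1) → ℝ) (hc : c (Fin.last n) = 0) :
    tailSum (gaps c) = c := by
  funext k
  induction k using Fin.reverseInduction with
  | last => rw [tailSum_last, hc]
  | cast i ih => rw [tailSum_castSucc, ih, gaps]; ring

lemma sum_gaps {n : ℕ} (c : Fin (n + 1) → ℝ) (hc : c (Fin.last n) = 0) :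
    ∑ j, gaps c j = c 0 := by
  rw [← tailSum_zero, tailSum_gaps c hc]

/-- The point of `ℝ^d` whose sequence `x_{π(1)}, …, x_{π(d)}` consists of tail sums of `l`. -/
def pointOfGaps (π : Equiv.Perm (Fin d)) (l : Fin (d + 1) → ℝ) (i : Fin d) : ℝ :=
  tailSum l (π.symm i).castSucc.succ

lemma dilChain_pointOfGaps (π : Equiv.Perm (Fin d)) (l : Fin (d + 1) → ℝ) :
    dilChain π (∑ j, l j) (pointOfGaps π l) = tailSum l := by
  funext k
  induction k using chainIndex_cases with
  | h0 => rw [dilChain_zero, tailSum_zero]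
  | hl => rw [dilChain_last, tailSum_last]
  | hm i => rw [dilChain_mid, pointOfGaps, Equiv.symm_apply_apply]

/-- With `pointOfGaps_gaps_dilChain`, this makes the gaps barycentric coordinates: `ℝ^d` is
identified with the hyperplane of coordinate sum `t`. -/
lemma gaps_dilChain_pointOfGaps (π : Equiv.Perm (Fin d)) (l : Fin (d + 1) → ℝ) (t : ℝ)
    (ht : ∑ j, l j = t) : gaps (dilChain π t (pointOfGaps π l)) = l := by
  rw [← ht, dilChain_pointOfGaps, gaps_tailSum]

lemma pointOfGaps_gaps_dilChain (π : Equiv.Perm (Fin d)) (t : ℝ) (x : Fin d → ℝ) :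
    pointOfGaps π (gaps (dilChain π t x)) = x := by
  funext i
  rw [pointOfGaps, tailSum_gaps _ (dilChain_last _ _ _), dilChain_mid, Equiv.apply_symm_apply]

lemma sum_gaps_dilChain (π : Equiv.Perm (Fin d)) (t : ℝ) (x : Fin d → ℝ) :
    ∑ j, gaps (dilChain π t x) j = t := by
  rw [sum_gaps _ (dilChain_last _ _ _), dilChain_zero]

lemma pointOfGaps_nonneg (π : Equiv.Perm (Fin d)) (l : Fin (d + 1) → ℝ) (hl : ∀ j, 0 ≤ l j)
    (i : Fin d) : 0 ≤ pointOfGaps π l i := by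
  rw [pointOfGaps, tailSum]
  exact Finset.sum_nonneg fun j _ => hl j

lemma pointOfGaps_le_sum (π : Equiv.Perm (Fin d)) (l : Fin (d + 1) → ℝ) (hl : ∀ j, 0 ≤ l j)
    (i : Fin d) : pointOfGaps π l i ≤ ∑ j, l j := by
  rw [pointOfGaps, tailSum]
  exact Finset.sum_le_sum_of_subset_of_nonneg (Finset.filter_subset _ _) fun j _ _ => hl j

open Classical in
/-- The set of strict inequalities of `s`. -/
noncomputable def strictSet (s : Fin (d + 1) → RelSymbol) : Finset (Fin (d + 1)) := {j | s j = .lt}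

lemma mem_strictSet {s : Fin (d + 1) → RelSymbol} {j : Fin (d + 1)} :
    j ∈ strictSet s ↔ s j = .lt := by simp [strictSet]

/-- Without `≤`, each symbol makes its gap either zero or positive, so only the set of strict
symbols matters. -/
lemma forall_holds_iff {s : Fin (d + 1) → RelSymbol} (hs : ∀ j, s j ≠ .le)
    (c : Fin (d + 2) → ℝ) :
    (∀ j, (s j).Holds (c j.succ) (c j.castSucc)) ↔
      (∀ j ∉ strictSet s, gaps c j = 0) ∧ ∀ j ∈ strictSet s, 0 < gaps c j := by
  simp only [mem_strictSet, gaps, ← forall_and]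
  refine forall_congr' fun j => ?_
  cases h : s j
  · simp [RelSymbol.Holds, sub_eq_zero, eq_comm]
  · exact absurd h (hs j)
  · simp [RelSymbol.Holds]

lemma mem_alcove0_iff {π : Equiv.Perm (Fin d)} {s : Fin (d + 1) → RelSymbol}
    (hs : ∀ j, s j ≠ .le) (x : Fin d → ℝ) :
    x ∈ alcove0 π s ↔ (∀ j ∉ strictSet s, gaps (dilChain π 1 x) j = 0) ∧
      ∀ j ∈ strictSet s, 0 < gaps (dilChain π 1 x) j :=
  forall_holds_iff hs _

/-- Treating the dilation level as an extra coordinate makes the chain linear. This covers dilation,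
affine combinations (level `1`) and directions (level `0`) at once. -/
lemma dilChain_lin (π : Equiv.Perm (Fin d)) (t u α β : ℝ) (x y : Fin d → ℝ) (k : Fin (d + 2)) :
    dilChain π (α * t + β * u) (α • x + β • y) k = α * dilChain π t x k + β * dilChain π u y k := by
  induction k using chainIndex_cases with
  | h0 => simp
  | hl => simp
  | hm i => simp

lemma gaps_dilChain_lin (π : Equiv.Perm (Fin d)) (t u α β : ℝ) (x y : Fin d → ℝ)
    (j : Fin (d + 1)) :
    gaps (dilChain π (α * t + β * u) (α • x + β • y)) j =
      α * gaps (dilChain π t x) j + β * gaps (dilChain π u y) j := by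
  simp only [gaps, dilChain_lin]
  ring

lemma continuous_gaps_dilChain (π : Equiv.Perm (Fin d)) (t : ℝ) (j : Fin (d + 1)) :
    Continuous fun x : Fin d → ℝ => gaps (dilChain π t x) j := by
  have h : ∀ k, Continuous fun x : Fin d → ℝ => dilChain π t x k := fun k => by
    induction k using chainIndex_cases with
    | h0 => exact continuous_const
    | hl => simpa only [dilChain_last] using continuous_const
    | hm i => simpa only [dilChain_mid] using continuous_apply (π i)
  exact (h _).sub (h _)

lemma mem_closure_alcove0_iff {π : Equiv.Perm (Fin d)} {s : Fin (d + 1) → RelSymbol}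
    (hs : ∀ j, s j ≠ .le) (hne : (alcove0 π s).Nonempty) (x : Fin d → ℝ) :
    x ∈ closure (alcove0 π s) ↔ (∀ j ∉ strictSet s, gaps (dilChain π 1 x) j = 0) ∧
      ∀ j ∈ strictSet s, 0 ≤ gaps (dilChain π 1 x) j := by
  constructor
  · intro hx
    have hcl : IsClosed {x : Fin d → ℝ | (∀ j ∉ strictSet s, gaps (dilChain π 1 x) j = 0) ∧
        ∀ j ∈ strictSet s, 0 ≤ gaps (dilChain π 1 x) j} := by
      simp only [Set.ofPred_and, Set.ofPred_forall]
      refine IsClosed.inter ?_ ?_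
      · exact isClosed_iInter fun j => isClosed_iInter fun _ =>
          isClosed_eq (continuous_gaps_dilChain π 1 j) continuous_const
      · exact isClosed_iInter fun j => isClosed_iInter fun _ =>
          isClosed_le continuous_const (continuous_gaps_dilChain π 1 j)
    refine closure_minimal (fun y hy => ?_) hcl hx
    obtain ⟨h1, h2⟩ := (mem_alcove0_iff hs y).1 hy
    exact ⟨h1, fun j hj => (h2 j hj).le⟩
  · rintro ⟨h1, h2⟩
    obtain ⟨y, hy⟩ := hne
    obtain ⟨y1, y2⟩ := (mem_alcove0_iff hs y).1 hy
    -- A point satisfying the weak inequalities is approached along the segment towards a point `y`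
    -- of the open simplex; for `0 < ε < 1` the strict inequalities hold on it.
    have hlim : Filter.Tendsto (fun ε : ℝ => (1 - ε) • x + ε • y) (nhdsWithin 0 (Set.Ioo 0 1))
        (nhds x) := by
      have : Continuous fun ε : ℝ => (1 - ε) • x + ε • y := by fun_prop
      simpa using (this.tendsto 0).mono_left nhdsWithin_le_nhds
    have : (nhdsWithin (0 : ℝ) (Set.Ioo 0 1)).NeBot := by
      rw [← mem_closure_iff_nhdsWithin_neBot, closure_Ioo zero_ne_one]
      simp
    refine mem_closure_of_tendsto hlim ?_
    filter_upwards [self_mem_nhdsWithin] with ε hε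
    rw [mem_alcove0_iff hs]
    have key : ∀ j, gaps (dilChain π 1 ((1 - ε) • x + ε • y)) j =
        (1 - ε) * gaps (dilChain π 1 x) j + ε * gaps (dilChain π 1 y) j := fun j => by
      rw [← gaps_dilChain_lin]; congr 2; ring
    refine ⟨fun j hj => by rw [key, h1 j hj, y1 j hj]; ring, fun j hj => ?_⟩
    rw [key]
    have := mul_nonneg (sub_nonneg.2 hε.2.le) (h2 j hj)
    have := mul_pos hε.1 (y2 j hj)
    linarith

/-! ### Directions and dimension of an alcoved simplex. -/

lemma strictSet_nonempty {π : Equiv.Perm (Fin d)} {s : Fin (d + 1) → RelSymbol}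
    (hs : ∀ j, s j ≠ .le) (hne : (alcove0 π s).Nonempty) : (strictSet s).Nonempty := by
  by_contra h
  rw [Finset.not_nonempty_iff_eq_empty] at h
  obtain ⟨x, hx⟩ := hne
  have h1 := ((mem_alcove0_iff hs x).1 hx).1
  have := sum_gaps_dilChain π 1 x
  rw [Finset.sum_eq_zero fun j _ => h1 j (by simp [h])] at this
  exact zero_ne_one this

/-- The directions of an alcoved simplex. -/
def alcoveDirection (π : Equiv.Perm (Fin d)) (J : Finset (Fin (d + 1))) :
    Submodule ℝ (Fin d → ℝ) where
  carrier := {v | ∀ j ∉ J, gaps (dilChain π 0 v) j = 0}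
  zero_mem' j hj := by
    simpa using gaps_dilChain_lin π 0 0 0 0 (0 : Fin d → ℝ) 0 j
  add_mem' {v w} hv hw j hj := by
    simpa [hv j hj, hw j hj] using gaps_dilChain_lin π 0 0 1 1 v w j
  smul_mem' c v hv j hj := by
    simpa [hv j hj] using gaps_dilChain_lin π 0 0 c 0 v 0 j

/-- The sum of the coordinates as a linear form. -/
def coordSum (κ : Type*) [Fintype κ] : (κ → ℝ) →ₗ[ℝ] ℝ where
  toFun l := ∑ j, l j
  map_add' l l' := Finset.sum_add_distrib
  map_smul' c l := by simp [Finset.mul_sum]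

lemma sum_extendZero (J : Finset (Fin (d + 1))) (l : J → ℝ) :
    ∑ j, (if h : j ∈ J then l ⟨j, h⟩ else 0) = ∑ j, l j := by
  rw [← Finset.sum_subset (Finset.subset_univ J) (fun j _ hj => by simp [hj]),
    ← Finset.sum_coe_sort J]
  simp

/-- Barycentric coordinates of the directions of an alcoved simplex. -/
def alcoveDirectionEquiv (π : Equiv.Perm (Fin d)) (J : Finset (Fin (d + 1))) :
    alcoveDirection π J ≃ₗ[ℝ] LinearMap.ker (coordSum J) where
  toFun v := ⟨fun j => gaps (dilChain π 0 v.1) j, by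
    change ∑ j : J, gaps (dilChain π 0 v.1) j = 0
    rw [Finset.sum_coe_sort J (gaps (dilChain π 0 v.1)), Finset.sum_subset (Finset.subset_univ J)
      (fun j _ hj => v.2 j hj), sum_gaps_dilChain]⟩
  map_add' v w := by
    ext j
    simpa using gaps_dilChain_lin π 0 0 1 1 v.1 w.1 j
  map_smul' c v := by
    ext j
    simpa using gaps_dilChain_lin π 0 0 c 0 v.1 0 j
  invFun l := ⟨pointOfGaps π (fun j => if h : j ∈ J then l.1 ⟨j, h⟩ else 0), fun j hj => by
    rw [gaps_dilChain_pointOfGaps _ _ _ ((sum_extendZero J l.1).trans l.2)]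
    simp [hj]⟩
  left_inv v := by
    ext1
    conv_rhs => rw [← pointOfGaps_gaps_dilChain π 0 v.1]
    simp only
    congr 1
    funext j
    split_ifs with h
    · rfl
    · rw [v.2 j h]
  right_inv l := by
    ext j
    simp only
    rw [gaps_dilChain_pointOfGaps _ _ _ ((sum_extendZero J l.1).trans l.2)]
    simp

lemma finrank_alcoveDirection (π : Equiv.Perm (Fin d)) {J : Finset (Fin (d + 1))}
    (hJ : J.Nonempty) : Module.finrank ℝ (alcoveDirection π J) + 1 = #J := by
  obtain ⟨j₀, hj₀⟩ := hJ
  -- The directions are the kernel of the coordinate sum on `ℝ^J`; as `J` is nonempty, this form is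
  -- onto and the kernel has codimension one.
  have hsurj : Function.Surjective (coordSum J) := fun r =>
    ⟨Pi.single ⟨j₀, hj₀⟩ r, by simp [coordSum]⟩
  have h := LinearMap.finrank_range_add_finrank_ker (coordSum J)
  rw [LinearMap.range_eq_top.2 hsurj, finrank_top, Module.finrank_self,
    Module.finrank_fintype_fun_eq_card, Fintype.card_coe] at h
  rw [(alcoveDirectionEquiv π J).finrank_eq]
  omega

lemma vectorSpan_alcove0 {π : Equiv.Perm (Fin d)} {s : Fin (d + 1) → RelSymbol}
    (hs : ∀ j, s j ≠ .le) (hne : (alcove0 π s).Nonempty) :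
    vectorSpan ℝ (alcove0 π s) = alcoveDirection π (strictSet s) := by
  apply le_antisymm
  · rw [vectorSpan_def, Submodule.span_le]
    rintro _ ⟨x, hx, y, hy, rfl⟩ j hj
    have := gaps_dilChain_lin π 1 1 1 (-1) x y j
    rw [((mem_alcove0_iff hs x).1 hx).1 j hj, ((mem_alcove0_iff hs y).1 hy).1 j hj] at this
    simpa [sub_eq_add_neg] using this
  · intro v hv
    obtain ⟨x, hx⟩ := hne
    obtain ⟨x1, x2⟩ := (mem_alcove0_iff hs x).1 hx
    -- The simplex is relatively open: finitely many strict inequalities survive a small step in any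
    -- allowed direction.
    have hev : ∀ᶠ ε : ℝ in nhdsWithin 0 (Set.Ioi 0), ∀ j ∈ strictSet s,
        0 < gaps (dilChain π 1 x) j + ε * gaps (dilChain π 0 v) j := by
      refine (Filter.eventually_all_finset _).2 fun j hj => ?_
      have hc : Continuous fun ε : ℝ => gaps (dilChain π 1 x) j + ε * gaps (dilChain π 0 v) j := by
        fun_prop
      refine nhdsWithin_le_nhds ((hc.tendsto 0).eventually (lt_mem_nhds ?_))
      simpa using x2 j hj
    obtain ⟨ε, hε, hε0⟩ := (hev.and self_mem_nhdsWithin).exists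
    have hε0 : (0 : ℝ) < ε := hε0
    have hy : x + ε • v ∈ alcove0 π s := by
      have key : ∀ j, gaps (dilChain π 1 (x + ε • v)) j =
          gaps (dilChain π 1 x) j + ε * gaps (dilChain π 0 v) j := fun j => by
        simpa using gaps_dilChain_lin π 1 0 1 ε x v j
      exact (mem_alcove0_iff hs _).2
        ⟨fun j hj => by rw [key, x1 j hj, hv j hj]; ring, fun j hj => by rw [key]; exact hε j hj⟩
    have := Submodule.smul_mem _ ε⁻¹ (vsub_mem_vectorSpan ℝ hy hx)
    simpa [smul_smul, hε0.ne'] using this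

open scoped Pointwise in
lemma affDim_alcove {π : Equiv.Perm (Fin d)} {s : Fin (d + 1) → RelSymbol} {a : Fin d → ℤ}
    (hs : ∀ j, s j ≠ .le) (hne : (alcove0 π s).Nonempty) :
    #(strictSet s) = affDim (alcove π s a) + 1 := by
  have : alcove π s a = (fun j => (a j : ℝ)) +ᵥ alcove0 π s := rfl
  rw [affDim, this, vectorSpan_vadd, vectorSpan_alcove0 hs hne,
    finrank_alcoveDirection π (strictSet_nonempty hs hne)]

end TropEhr

/-! ## Counting lattice points in a single alcoved simplex -/

namespace TropEhr

open Finset Polynomial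

variable {d : ℕ}

lemma pointOfGaps_add (π : Equiv.Perm (Fin d)) (l l' : Fin (d + 1) → ℝ) (i : Fin d) :
    pointOfGaps π (l + l') i = pointOfGaps π l i + pointOfGaps π l' i := by
  simp only [pointOfGaps, tailSum, Pi.add_apply, Finset.sum_add_distrib]

lemma pointOfGaps_neg (π : Equiv.Perm (Fin d)) (l : Fin (d + 1) → ℝ) (i : Fin d) :
    pointOfGaps π (-l) i = -pointOfGaps π l i := by
  simp only [pointOfGaps, tailSum, Pi.neg_apply, Finset.sum_neg_distrib]

/-- The barycentric coordinates of the points `x` with `Σ l ∈ ℤ` and `B_i x_i ∈ ℤ` for all `i`. -/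
def scaledLattice (π : Equiv.Perm (Fin d)) (B : Fin d → ℕ) : AddSubgroup (Fin (d + 1) → ℝ) where
  carrier := {l | (∃ n : ℤ, ∑ j, l j = n) ∧ ∀ i, ∃ n : ℤ, B i * pointOfGaps π l i = n}
  zero_mem' := ⟨⟨0, by simp⟩, fun i => ⟨0, by simp [pointOfGaps, tailSum]⟩⟩
  add_mem' := by
    rintro l l' ⟨⟨n, hn⟩, h⟩ ⟨⟨n', hn'⟩, h'⟩
    refine ⟨⟨n + n', by simp [Finset.sum_add_distrib, hn, hn']⟩, fun i => ?_⟩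
    obtain ⟨m, hm⟩ := h i
    obtain ⟨m', hm'⟩ := h' i
    exact ⟨m + m', by rw [pointOfGaps_add, mul_add, hm, hm']; push_cast; rfl⟩
  neg_mem' := by
    rintro l ⟨⟨n, hn⟩, h⟩
    refine ⟨⟨-n, by simp [hn]⟩, fun i => ?_⟩
    obtain ⟨m, hm⟩ := h i
    exact ⟨-m, by rw [pointOfGaps_neg, mul_neg, hm]; push_cast; rfl⟩

lemma int_mem_scaledLattice (π : Equiv.Perm (Fin d)) (B : Fin d → ℕ) (n : Fin (d + 1) → ℤ) :
    (fun j => (n j : ℝ)) ∈ scaledLattice π B := by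
  refine ⟨⟨∑ j, n j, by simp⟩, fun i => ⟨B i * ∑ j with (π.symm i).castSucc.succ ≤ Fin.castSucc j,
    n j, by simp [pointOfGaps, tailSum]⟩⟩

/-- A box point is determined by its integral coordinate sum and the integers `B_i x_i`, all of
which are bounded. -/
lemma finite_scaledLattice_box (π : Equiv.Perm (Fin d)) (B : Fin d → ℕ) (hB : ∀ i, 0 < B i) :
    {l ∈ (scaledLattice π B : Set (Fin (d + 1) → ℝ)) | ∀ j, 0 ≤ l j ∧ l j < 1}.Finite := by
  refine (((Set.finite_Icc (0 : ℤ) (d + 1 : ℕ)).prod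
    (Set.finite_Icc (0 : Fin d → ℤ) fun i => (B i : ℤ) * (d + 1 : ℕ))).image
    (fun q => gaps (dilChain π (q.1 : ℝ) fun i => (q.2 i : ℝ) / B i))).subset ?_
  rintro l ⟨⟨⟨n, hn⟩, h⟩, hl⟩
  choose y hy using h
  have hsum : ∑ j, l j ≤ (d + 1 : ℕ) := by
    calc ∑ j, l j ≤ ∑ j : Fin (d + 1), (1 : ℝ) := Finset.sum_le_sum fun j _ => (hl j).2.le
      _ = (d + 1 : ℕ) := by simp
  have hnn : ∀ i, 0 ≤ pointOfGaps π l i := pointOfGaps_nonneg π l fun j => (hl j).1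
  refine ⟨(n, y), ⟨⟨?_, ?_⟩, ⟨fun i => ?_, fun i => ?_⟩⟩, ?_⟩
  · have : (0 : ℝ) ≤ n := hn ▸ Finset.sum_nonneg fun j _ => (hl j).1
    exact_mod_cast this
  · have : (n : ℝ) ≤ (d + 1 : ℕ) := hn ▸ hsum
    exact_mod_cast this
  · have : (0 : ℝ) ≤ y i := hy i ▸ mul_nonneg (Nat.cast_nonneg _) (hnn i)
    exact_mod_cast this
  · have : (y i : ℝ) ≤ B i * (d + 1 : ℕ) := by
      rw [← hy i]
      exact mul_le_mul_of_nonneg_left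
        ((pointOfGaps_le_sum π l (fun j => (hl j).1) i).trans hsum) (Nat.cast_nonneg _)
    exact_mod_cast this
  · have : (fun i => (y i : ℝ) / B i) = pointOfGaps π l := funext fun i => by
      have : (B i : ℝ) ≠ 0 := by exact_mod_cast (hB i).ne'
      rw [← hy i]; field_simp
    simp only [this, ← hn]
    exact gaps_dilChain_pointOfGaps π l _ rfl

lemma injOn_pointOfGaps (π : Equiv.Perm (Fin d)) (t : ℝ) :
    Set.InjOn (pointOfGaps π) {l | ∑ j, l j = t} := fun l hl l' hl' h => by
  rw [← gaps_dilChain_pointOfGaps π l t hl, h, gaps_dilChain_pointOfGaps π l' t hl']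

lemma diagImage_natCast (b : ℕ) (e : Fin d → ℕ) (Q : Set (Fin d → ℝ)) :
    diagImage b (fun j => (e j : ℤ)) Q = (fun x j => ((b ^ e j : ℕ) : ℝ) * x j) '' Q := by
  refine Set.image_congr fun x _ => funext fun j => ?_
  simp [Matrix.mulVec_diagonal]

/-- The lattice points of the dilates of the closed simplex, in barycentric coordinates. -/
lemma dilate_inter_intLattice {π : Equiv.Perm (Fin d)} {s : Fin (d + 1) → RelSymbol}
    (hs : ∀ j, s j ≠ .le) (hne : (alcove0 π s).Nonempty) (B : Fin d → ℕ) (t : ℕ) (ht : 0 < t) :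
    ((fun x : Fin d → ℝ => (t : ℝ) • x) '' ((fun x j => (B j : ℝ) * x j) '' closure (alcove0 π s)))
        ∩ intLattice d =
      (fun l j => (B j : ℝ) * pointOfGaps π l j) ''
        {l ∈ (scaledLattice π B : Set (Fin (d + 1) → ℝ)) |
          (∀ j ∉ strictSet s, l j = 0) ∧ (∀ j ∈ strictSet s, 0 ≤ l j) ∧ ∑ j, l j = t} := by
  have ht' : (0 : ℝ) < t := by exact_mod_cast ht
  ext y
  constructor
  · rintro ⟨⟨_, ⟨x, hx, rfl⟩, rfl⟩, hy⟩
    obtain ⟨x1, x2⟩ := (mem_closure_alcove0_iff hs hne x).1 hx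
    have key : ∀ j, gaps (dilChain π t ((t : ℝ) • x)) j = t * gaps (dilChain π 1 x) j := fun j => by
      simpa using gaps_dilChain_lin π 1 0 t 0 x 0 j
    have hpt : ∀ j, (B j : ℝ) * pointOfGaps π (gaps (dilChain π t ((t : ℝ) • x))) j =
        ((t : ℝ) • fun j => (B j : ℝ) * x j) j := fun j => by
      rw [pointOfGaps_gaps_dilChain]
      simp only [Pi.smul_apply, smul_eq_mul]
      ring
    refine ⟨gaps (dilChain π t ((t : ℝ) • x)), ⟨⟨⟨t, by rw [sum_gaps_dilChain]; simp⟩, fun i => ?_⟩,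
      fun j hj => ?_, fun j hj => ?_, sum_gaps_dilChain _ _ _⟩, funext hpt⟩
    · rw [hpt]; exact hy i
    · rw [key, x1 j hj, mul_zero]
    · rw [key]; exact mul_nonneg ht'.le (x2 j hj)
  · rintro ⟨l, ⟨⟨-, hl⟩, l1, l2, l3⟩, rfl⟩
    refine ⟨⟨_, ⟨(t : ℝ)⁻¹ • pointOfGaps π l, ?_, rfl⟩, ?_⟩, hl⟩
    · have key : ∀ j, gaps (dilChain π 1 ((t : ℝ)⁻¹ • pointOfGaps π l)) j = (t : ℝ)⁻¹ * l j :=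
        fun j => by
          have := gaps_dilChain_lin π t 0 (t : ℝ)⁻¹ 0 (pointOfGaps π l) 0 j
          rwa [gaps_dilChain_pointOfGaps π l t l3, inv_mul_cancel₀ ht'.ne', zero_smul, zero_mul,
            zero_mul, add_zero, add_zero, add_zero] at this
      rw [mem_closure_alcove0_iff hs hne]
      refine ⟨fun j hj => by rw [key, l1 j hj, mul_zero], fun j hj => ?_⟩
      rw [key]
      exact mul_nonneg (inv_nonneg.2 ht'.le) (l2 j hj)
    · funext j
      simp only [Pi.smul_apply, smul_eq_mul]
      field_simp

/-- For increasing `G`, all relations in the chain are preserved, so `G` applied coordinatewise maps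
points of the unit simplex into its dilate by `G 1`. -/
lemma dilChain_comp (π : Equiv.Perm (Fin d)) (x : Fin d → ℝ) (G : ℝ → ℝ) (hG : G 0 = 0)
    (k : Fin (d + 2)) : dilChain π (G 1) (fun i => G (x i)) k = G (dilChain π 1 x k) := by
  induction k using chainIndex_cases with
  | h0 => simp
  | hl => simp [hG]
  | hm i => simp

lemma holds_comp_iff (r : RelSymbol) {G : ℝ → ℝ} (hG : StrictMono G) (x y : ℝ) :
    r.Holds (G x) (G y) ↔ r.Holds x y := by
  cases r
  · exact hG.injective.eq_iff
  · exact hG.le_iff_le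
  · exact hG.lt_iff_lt

lemma mem_alcove_iff {π : Equiv.Perm (Fin d)} {s : Fin (d + 1) → RelSymbol} {a : Fin d → ℤ}
    {x : Fin d → ℝ} : x ∈ alcove π s a ↔ (fun j => x j - a j) ∈ alcove0 π s := by
  constructor
  · rintro ⟨u, hu, rfl⟩
    simpa using hu
  · exact fun h => ⟨_, h, by simp⟩

/-- The points of `σ` whose `k`-th tropical dilates lie in the tropical lattice. -/
def tropPoints (b k : ℕ) (σ : Set (Fin d → ℝ)) : Set (Fin d → ℝ) :=
  {x ∈ σ | ∀ j, ∃ n : ℕ, (b : ℝ) ^ ((k : ℝ) + x j) = n}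

/-- The exponential map sends tropical lattice points of a simplex to lattice points of a dilate of
its linear image; here in barycentric coordinates. -/
lemma image_tropPoints_alcove {b : ℕ} (hb : 2 ≤ b) {π : Equiv.Perm (Fin d)}
    {s : Fin (d + 1) → RelSymbol} (hs : ∀ j, s j ≠ .le) (e : Fin d → ℕ) (k : ℕ) :
    ∃ Φ : (Fin d → ℝ) → Fin (d + 1) → ℝ, Function.Injective Φ ∧
      Φ '' tropPoints b k (alcove π s fun j => (e j : ℤ)) =
        {l ∈ (scaledLattice π fun j => b ^ e j : Set (Fin (d + 1) → ℝ)) |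
          (∀ j ∉ strictSet s, l j = 0) ∧ (∀ j ∈ strictSet s, 0 < l j) ∧
            ∑ j, l j = ((b - 1) * b ^ k : ℕ)} := by
  have hb1 : (1 : ℝ) < b := by exact_mod_cast hb
  have hb0 : (0 : ℝ) < b := by linarith
  have hbk : (0 : ℝ) < (b : ℝ) ^ k := by positivity
  set t : ℕ := (b - 1) * b ^ k with ht
  have htR : (t : ℝ) = (b - 1) * b ^ k := by
    rw [ht]; push_cast [Nat.cast_sub (show 1 ≤ b by omega)]; ring
  set G : ℝ → ℝ := fun u => (b : ℝ) ^ k * ((b : ℝ) ^ u - 1) with hGdef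
  have hG : StrictMono G := fun u v huv =>
    mul_lt_mul_of_pos_left (sub_lt_sub_right (Real.rpow_lt_rpow_of_exponent_lt hb1 huv) 1) hbk
  have hG0 : G 0 = 0 := by simp [hGdef]
  have hG1 : G 1 = t := by simp only [hGdef, Real.rpow_one, htR]; ring
  -- The correction `b^(k+n)` is an integer because the corner is nonnegative, so `b^(k+x)` is
  -- integral exactly when the scaled coordinate is.
  have hpow : ∀ (x : ℝ) (n : ℕ), (b : ℝ) ^ n * G (x - n) = (b : ℝ) ^ ((k : ℝ) + x) - b ^ (k + n) :=
    fun x n => by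
      simp only [hGdef]
      rw [mul_left_comm, mul_sub, ← Real.rpow_natCast b n, ← Real.rpow_add hb0, add_sub_cancel,
        mul_sub, ← Real.rpow_natCast b k, ← Real.rpow_add hb0, ← Real.rpow_natCast b (k + n),
        mul_one, ← Real.rpow_add hb0]
      push_cast; rfl
  have mem : ∀ u : Fin d → ℝ, u ∈ alcove0 π s ↔
      (∀ j ∉ strictSet s, gaps (dilChain π t fun i => G (u i)) j = 0) ∧
        ∀ j ∈ strictSet s, 0 < gaps (dilChain π t fun i => G (u i)) j := fun u => by
    rw [← forall_holds_iff hs, ← hG1]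
    simp only [dilChain_comp π u G hG0, holds_comp_iff _ hG]
    rfl
  refine ⟨fun x => gaps (dilChain π t fun i => G (x i - e i)), fun x y hxy => ?_, ?_⟩
  · have := congrArg (pointOfGaps π) hxy
    simp only [pointOfGaps_gaps_dilChain] at this
    funext i
    have := hG.injective (congrFun this i)
    linarith
  · ext l
    constructor
    · rintro ⟨x, ⟨hx, hn⟩, rfl⟩
      have hx' := (mem _).1 (mem_alcove_iff.1 hx)
      simp only [Int.cast_natCast] at hx'
      refine ⟨⟨⟨t, by rw [sum_gaps_dilChain]; simp⟩, fun i => ?_⟩, hx'.1, hx'.2,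
        sum_gaps_dilChain _ _ _⟩
      obtain ⟨n, hn⟩ := hn i
      refine ⟨n - b ^ (k + e i), ?_⟩
      rw [pointOfGaps_gaps_dilChain]
      push_cast
      rw [hpow, hn]
    · rintro ⟨⟨-, hl⟩, l1, l2, l3⟩
      have hl0 : ∀ j, 0 ≤ l j := fun j => by
        by_cases hj : j ∈ strictSet s
        · exact (l2 j hj).le
        · rw [l1 j hj]
      have hz := pointOfGaps_nonneg π l hl0
      -- This inverts `G`; the logarithm is defined because points with nonnegative gaps have
      -- nonnegative coordinates.
      set x : Fin d → ℝ := fun i => e i + Real.logb b (1 + pointOfGaps π l i / b ^ k) with hxdef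
      have hGx : (fun i => G (x i - e i)) = pointOfGaps π l := funext fun i => by
        have : 0 < 1 + pointOfGaps π l i / b ^ k := by
          have := div_nonneg (hz i) hbk.le
          linarith
        simp only [hxdef, hGdef, add_sub_cancel_left]
        rw [Real.rpow_logb hb0 hb1.ne' this]
        field_simp
        ring
      have hgl : gaps (dilChain π t fun i => G (x i - e i)) = l := by
        rw [hGx, gaps_dilChain_pointOfGaps π l t l3]
      refine ⟨x, ⟨?_, fun i => ?_⟩, hgl⟩
      · rw [mem_alcove_iff, mem]
        simp only [Int.cast_natCast, hgl]
        exact ⟨l1, l2⟩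
      · obtain ⟨n, hn⟩ := hl i
        have h1 := hpow (x i) (e i)
        rw [show G (x i - e i) = pointOfGaps π l i from congrFun hGx i] at h1
        push_cast at hn
        rw [hn] at h1
        have h2 : (b : ℝ) ^ ((k : ℝ) + x i) = ((n + b ^ (k + e i) : ℤ) : ℝ) := by
          push_cast; linarith
        have h3 : 0 ≤ n + (b : ℤ) ^ (k + e i) := by
          have : (0 : ℝ) ≤ ((n + b ^ (k + e i) : ℤ) : ℝ) := h2 ▸ (Real.rpow_pos_of_pos hb0 _).le
          exact_mod_cast this
        obtain ⟨m, hm⟩ := Int.eq_ofNat_of_zero_le h3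
        exact ⟨m, by rw [h2, hm, Int.cast_natCast]⟩

/-- The Ehrhart polynomial of a linear image of a closed alcoved simplex; by reciprocity, it also
counts the tropical lattice points of the tropical dilates of the relatively open simplex. -/
theorem exists_ehrhart_polynomial_alcove {b : ℕ} (hb : 2 ≤ b) {π : Equiv.Perm (Fin d)}
    {s : Fin (d + 1) → RelSymbol} {a : Fin d → ℤ} (hs : ∀ j, s j ≠ .le)
    (hne : (alcove π s a).Nonempty) (ha : 0 ≤ a) :
    ∃ p : ℝ[X], IsEhrhartPolynomial (diagImage b a (closure (alcove0 π s))) p ∧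
      p.natDegree ≤ affDim (alcove π s a) ∧
      ∀ k : ℕ, (tropPoints b k (alcove π s a)).Finite ∧
        ((tropPoints b k (alcove π s a)).ncard : ℝ) =
          (-1) ^ affDim (alcove π s a) * p.eval (-((b - 1) * (b : ℝ) ^ k)) := by
  have hne0 : (alcove0 π s).Nonempty := hne.of_image
  obtain ⟨e, rfl⟩ : ∃ e : Fin d → ℕ, a = fun j => (e j : ℤ) :=
    ⟨fun j => (a j).toNat, funext fun j => (Int.toNat_of_nonneg (ha j)).symm⟩
  have hB : ∀ i, 0 < b ^ e i := fun i => by positivity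
  obtain ⟨p, hp, hcl, hop⟩ := exists_polynomial_card_simplex (strictSet s)
    (affDim (alcove π s fun j => (e j : ℤ))) (affDim_alcove hs hne0)
    (scaledLattice π fun j => b ^ e j) (int_mem_scaledLattice π _) (fun l hl => hl.1)
    (finite_scaledLattice_box π _ hB)
  refine ⟨p, fun t ht => ?_, hp, fun k => ?_⟩
  · obtain ⟨hf, hc⟩ := hcl t
    rw [diagImage_natCast, dilate_inter_intLattice hs hne0 (fun j => b ^ e j) t ht]
    refine ⟨hf.image _, ?_⟩
    rw [Set.InjOn.ncard_image, hc]
    intro l hl l' hl' h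
    refine injOn_pointOfGaps π t hl.2.2.2 hl'.2.2.2 (funext fun i => ?_)
    exact mul_left_cancel₀ (by exact_mod_cast (hB i).ne') (congrFun h i)
  · obtain ⟨Φ, hΦ, himg⟩ := image_tropPoints_alcove hb (π := π) hs e k
    -- Reciprocity needs a positive dilation factor, which `b ≥ 2` ensures even for `k = 0`.
    obtain ⟨hf, hc⟩ := hop ((b - 1) * b ^ k) (Nat.mul_pos (by omega) (by positivity))
    rw [← himg] at hf hc
    refine ⟨hf.of_finite_image hΦ.injOn, ?_⟩
    rw [Set.ncard_image_of_injective _ hΦ] at hc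
    rw [hc]
    push_cast [Nat.cast_sub (show 1 ≤ b by omega)]
    rfl

end TropEhr

/-! ## Alcoves, the covector decomposition and membership in tropical polytopes -/

namespace TropEhr

variable {d : ℕ}

/-- Homogenization of real points. -/
def realHomog (x : Fin d → ℝ) : Fin (d + 1) → ℝ := Fin.cons (α := fun _ => ℝ) 0 x

lemma homog_toTrop (x : Fin d → ℝ) (l : Fin (d + 1)) :
    homog (toTrop x) l = (realHomog x l : WithBot ℝ) := by
  induction l using Fin.cases with
  | zero => rfl
  | succ i => rfl

/-- The points on the same side of all hyperplanes `x_i - x_j = n`, `n ∈ ℤ`, as `x`, where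
`x_0 = 0`. -/
def alcoveClass (x : Fin d → ℝ) : Set (Fin d → ℝ) :=
  {y | ∀ i j, ∀ n : ℤ, realHomog x i - realHomog x j ≤ n ↔ realHomog y i - realHomog y j ≤ n}

lemma self_mem_alcoveClass (x : Fin d → ℝ) : x ∈ alcoveClass x := fun _ _ _ => Iff.rfl

lemma alcoveClass_eq_of_mem {x y : Fin d → ℝ} (h : y ∈ alcoveClass x) :
    alcoveClass y = alcoveClass x := by
  ext z
  exact forall_congr' fun i => forall_congr' fun j => forall_congr' fun n => by rw [h i j n]

lemma chain_last (π : Equiv.Perm (Fin d)) (x : Fin d → ℝ) : chain π x (Fin.last _) = 0 :=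
  dilChain_last π 1 x

/-- Each chain entry is a homogeneous coordinate up to an integer, the end entries `1` and `0` being
shifts of `x_0 = 0`. Comparing chain entries thus means comparing some `x_i - x_j` with an integer;
surjectivity of `ρ` says that all pairs arise. -/
lemma chain_sub_eq (π : Equiv.Perm (Fin d)) (a : Fin d → ℤ) :
    ∃ (ρ : Fin (d + 2) → Fin (d + 1)) (e : Fin (d + 2) → ℤ), Function.Surjective ρ ∧
      ∀ x k, chain π (fun j => x j - a j) k = realHomog x (ρ k) + e k := by
  refine ⟨Fin.cons (α := fun _ => Fin (d + 1)) 0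
    (Fin.snoc (α := fun _ => Fin (d + 1)) (fun i => (π i).succ) 0),
    Fin.cons (α := fun _ => ℤ) 1 (Fin.snoc (α := fun _ => ℤ) (fun i => -a (π i)) 0), ?_, ?_⟩
  · intro i
    induction i using Fin.cases with
    | zero => exact ⟨0, rfl⟩
    | succ i => exact ⟨(π.symm i).castSucc.succ, by simp [Fin.cons_succ, Fin.snoc_castSucc]⟩
  · intro x k
    rw [chain_eq_dilChain]
    induction k using chainIndex_cases with
    | h0 => simp [realHomog]
    | hl => rw [dilChain_last, ← Fin.succ_last]; simp [realHomog, Fin.snoc_last]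
    | hm i => simp [realHomog, Fin.cons_succ, Fin.snoc_castSucc, sub_eq_add_neg]

lemma antitone_of_holds {n : ℕ} {s : Fin n → RelSymbol} {c : Fin (n + 1) → ℝ}
    (hc : ∀ j, (s j).Holds (c j.succ) (c j.castSucc)) : Antitone c := by
  refine Fin.antitone_iff_succ_le.2 fun j => ?_
  have := hc j
  cases h : s j <;> rw [h] at this
  · exact le_of_eq this
  · exact this
  · exact le_of_lt this

/-- The symbols determine the order of all entries: an earlier entry can be at most a later one only
if every symbol between them is `=`. -/
lemma le_of_holds {n : ℕ} {s : Fin n → RelSymbol} (hs : ∀ j, s j ≠ .le) {c c' : Fin (n + 1) → ℝ}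
    (hc : ∀ j, (s j).Holds (c j.succ) (c j.castSucc))
    (hc' : ∀ j, (s j).Holds (c' j.succ) (c' j.castSucc)) (k l : Fin (n + 1)) (h : c k ≤ c l) :
    c' k ≤ c' l := by
  induction l using Fin.induction with
  | zero => exact antitone_of_holds hc' (Fin.zero_le k)
  | succ l ih =>
    rcases le_or_gt l.succ k with hk | hk
    · exact antitone_of_holds hc' hk
    · have hk' : k ≤ l.castSucc := Fin.le_castSucc_iff.2 hk
      have h1 := antitone_of_holds hc (Fin.castSucc_le_succ l)
      have h2 := antitone_of_holds hc hk'
      have h3 := hc l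
      have h4 := hc' l
      cases hl : s l <;> rw [hl] at h3 h4
      · exact (ih (h.trans h1)).trans (ge_of_eq h4)
      · exact absurd hl (hs l)
      · exact absurd (show c l.succ < c l.castSucc from h3) (not_lt.2 (h2.trans h))

/-- The entries lie in `[0, 1]`, so only `N = 0` and `N = -1` carry information. The latter forces
`c k` to equal the last entry `0` and `c l` the first entry `1`. -/
lemma sub_le_intCast_of_holds {n : ℕ} {s : Fin n → RelSymbol} (hs : ∀ j, s j ≠ .le)
    {c c' : Fin (n + 1) → ℝ} (h0 : c 0 = 1) (h0' : c' 0 = 1) (hl : c (Fin.last n) = 0)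
    (hl' : c' (Fin.last n) = 0) (hc : ∀ j, (s j).Holds (c j.succ) (c j.castSucc))
    (hc' : ∀ j, (s j).Holds (c' j.succ) (c' j.castSucc)) (k l : Fin (n + 1)) (N : ℤ)
    (h : c k - c l ≤ N) : c' k - c' l ≤ N := by
  have hanti := antitone_of_holds hc
  have hanti' := antitone_of_holds hc'
  have u1 : ∀ i, c i ≤ 1 := fun i => h0 ▸ hanti (Fin.zero_le i)
  have u1' : ∀ i, c' i ≤ 1 := fun i => h0' ▸ hanti' (Fin.zero_le i)
  have u0 : ∀ i, 0 ≤ c i := fun i => hl ▸ hanti (Fin.le_last i)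
  have u0' : ∀ i, 0 ≤ c' i := fun i => hl' ▸ hanti' (Fin.le_last i)
  rcases lt_trichotomy N 0 with hN | rfl | hN
  · rcases (show N ≤ -2 ∨ N = -1 by omega) with hN | rfl
    · have : (N : ℝ) ≤ -2 := by exact_mod_cast hN
      linarith [u1 l, u0 k]
    · push_cast at h ⊢
      have h1 := le_of_holds hs hc hc' 0 l (by linarith [u0 k])
      have h2 := le_of_holds hs hc hc' k (Fin.last n) (by linarith [u1 l])
      linarith
  · push_cast at h ⊢
    linarith [le_of_holds hs hc hc' k l (by linarith)]
  · have : (1 : ℝ) ≤ N := by exact_mod_cast hN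
    linarith [u1' k, u0' l]

lemma holds_iff_of_sub (r : RelSymbol) {x y x' y' : ℝ}
    (h1 : x - y ≤ 0 ↔ x' - y' ≤ 0) (h2 : y - x ≤ 0 ↔ y' - x' ≤ 0) :
    r.Holds x y ↔ r.Holds x' y' := by
  simp only [sub_nonpos] at h1 h2
  cases r
  · simp only [RelSymbol.Holds, le_antisymm_iff, h1, h2]
  · exact h1
  · simp only [RelSymbol.Holds, ← not_le, h2]

/-- A relatively open alcoved simplex is the class of each of its points. -/
lemma alcove_eq_alcoveClass {π : Equiv.Perm (Fin d)} {s : Fin (d + 1) → RelSymbol}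
    {a : Fin d → ℤ} (hs : ∀ j, s j ≠ .le) {x : Fin d → ℝ} (hx : x ∈ alcove π s a) :
    alcove π s a = alcoveClass x := by
  obtain ⟨ρ, e, hρ, he⟩ := chain_sub_eq π a
  have hx' := mem_alcove_iff.1 hx
  ext y
  rw [mem_alcove_iff]
  constructor
  · intro hy i j n
    obtain ⟨k, rfl⟩ := hρ i
    obtain ⟨l, rfl⟩ := hρ j
    have key : ∀ z : Fin d → ℝ, realHomog z (ρ k) - realHomog z (ρ l) ≤ n ↔
        chain π (fun j => z j - a j) k - chain π (fun j => z j - a j) l ≤ (n + e k - e l : ℤ) := by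
      intro z
      rw [he, he]
      push_cast
      constructor <;> intro h <;> linarith
    rw [key, key]
    constructor
    · exact sub_le_intCast_of_holds hs rfl rfl (chain_last _ _) (chain_last _ _)
        hx' hy _ _ _
    · exact sub_le_intCast_of_holds hs rfl rfl (chain_last _ _) (chain_last _ _)
        hy hx' _ _ _
  · intro hy j
    have key : ∀ k l, chain π (fun j => x j - a j) k - chain π (fun j => x j - a j) l ≤ 0 ↔
        chain π (fun j => y j - a j) k - chain π (fun j => y j - a j) l ≤ 0 := by
      intro k l
      have := hy (ρ k) (ρ l) (e l - e k)
      simp only [he]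
      push_cast at this
      constructor <;> intro h
      · linarith [this.1 (by linarith)]
      · linarith [this.2 (by linarith)]
    exact (holds_iff_of_sub (s j) (key _ _) (key _ _)).1 (hx' j)

/-- Every point lies in a relatively open alcoved simplex with `a` its integral part. -/
lemma exists_mem_alcove_floor (x : Fin d → ℝ) :
    ∃ π s, (∀ j, s j ≠ RelSymbol.le) ∧ x ∈ alcove π s fun j => ⌊x j⌋ := by
  classical
  -- The negation sorts the fractional parts in decreasing order; below, `s` records which
  -- neighbours tie.
  set π := Tuple.sort fun j => -Int.fract (x j)
  have hπ : ∀ i j : Fin d, i ≤ j → Int.fract (x (π j)) ≤ Int.fract (x (π i)) := fun i j hij => by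
    simpa using Tuple.monotone_sort (fun j => -Int.fract (x j)) hij
  have hanti : ∀ j : Fin (d + 1), chain π (fun j => x j - ⌊x j⌋) j.succ ≤
      chain π (fun j => x j - ⌊x j⌋) j.castSucc := by
    intro j
    rw [chain_eq_dilChain]
    induction j using Fin.lastCases with
    | last =>
      rw [Fin.succ_last, dilChain_last]
      generalize (Fin.last d).castSucc = k
      induction k using chainIndex_cases with
      | h0 => simp
      | hl => simp
      | hm i => rw [dilChain_mid]; exact Int.fract_nonneg _
    | cast i =>
      rw [dilChain_mid]
      generalize hk : i.castSucc.castSucc = k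
      induction k using chainIndex_cases with
      | h0 => rw [dilChain_zero]; exact (Int.fract_lt_one _).le
      | hl =>
        have := congrArg Fin.val hk
        simp only [Fin.val_castSucc, Fin.val_last] at this
        omega
      | hm i' =>
        have := congrArg Fin.val hk
        simp only [Fin.val_castSucc, Fin.val_succ] at this
        rw [dilChain_mid]
        exact hπ i' i (Fin.le_def.2 (by omega))
  refine ⟨π, fun j => if chain π (fun j => x j - ⌊x j⌋) j.succ =
    chain π (fun j => x j - ⌊x j⌋) j.castSucc then .eq else .lt, fun j => ?_,
    mem_alcove_iff.2 fun j => ?_⟩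
  · dsimp only
    split_ifs <;> simp
  · split_ifs with h
    · exact h
    · exact lt_of_le_of_ne (hanti j) h

/-! ### Covectors and membership in tropical polytopes. -/

lemma exists_int_homog {v : Fin d → WithBot ℝ} (hv : v ∈ tropNat d) (hf : ∀ j, v j ≠ ⊥) :
    ∃ w : Fin (d + 1) → ℤ, ∀ l, homog v l = ((w l : ℝ) : WithBot ℝ) := by
  have : ∀ j, ∃ n : ℕ, v j = ((n : ℝ) : WithBot ℝ) := fun j => (hv j).resolve_left (hf j)
  choose n hn using this
  refine ⟨Fin.cons (α := fun _ => ℤ) 0 fun j => (n j : ℤ), fun l => ?_⟩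
  induction l using Fin.cases with
  | zero => simp [homog]
  | succ i => simp [homog, hn]

/-- Integral generators turn the covector conditions into inequalities of the kind recorded by
`alcoveClass`. -/
lemma mem_covector_iff {V : Finset (Fin d → WithBot ℝ)} {v : Fin d → WithBot ℝ} (hv : v ∈ V)
    {w : Fin (d + 1) → ℤ} (hw : ∀ l, homog v l = ((w l : ℝ) : WithBot ℝ)) (x : Fin d → ℝ)
    (k : Fin (d + 1)) : (v, k) ∈ covector V x ↔
      ∀ l, realHomog x k - realHomog x l ≤ (w k - w l : ℤ) := by
  have : (v, k) ∈ covector V x ↔ ∀ l, homog (toTrop x) k + homog v l ≤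
      homog (toTrop x) l + homog v k := ⟨fun h => h.2, fun h => ⟨hv, h⟩⟩
  rw [this]
  refine forall_congr' fun l => ?_
  rw [homog_toTrop, homog_toTrop, hw, hw, ← WithBot.coe_add, ← WithBot.coe_add, WithBot.coe_le_coe]
  push_cast
  constructor <;> intro h <;> linarith

lemma covector_eq_of_mem_alcoveClass {V : Finset (Fin d → WithBot ℝ)}
    (hV : ∀ v ∈ V, v ∈ tropNat d) (hfin : ∀ v ∈ V, ∀ j, v j ≠ ⊥) {x y : Fin d → ℝ}
    (h : y ∈ alcoveClass x) : covector V y = covector V x := by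
  ext ⟨v, k⟩
  by_cases hv : v ∈ V
  · obtain ⟨w, hw⟩ := exists_int_homog (hV v hv) (hfin v hv)
    rw [mem_covector_iff hv hw, mem_covector_iff hv hw]
    exact forall_congr' fun l => (h k l _).symm
  · exact ⟨fun h => absurd h.1 hv, fun h => absurd h.1 hv⟩

/-- Membership in a tropical polytope with homogenized coordinates. -/
lemma mem_tconv_iff_homog (V : Finset (Fin d → WithBot ℝ)) (x : Fin d → WithBot ℝ) :
    x ∈ tconv V ↔ ∃ c : (Fin d → WithBot ℝ) → WithBot ℝ,
      ∀ l, homog x l = V.sup fun v => c v + homog v l := by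
  -- The normalization `V.sup c = 0` is the equation for the added zeroth coordinate.
  refine exists_congr fun c => ⟨fun h l => ?_, fun h => ⟨?_, fun j => h j.succ⟩⟩
  · induction l using Fin.cases with
    | zero => simpa [homog] using h.1.symm
    | succ i => exact h.2 i
  · simpa [homog] using (h 0).symm

/-- The largest coefficient of `v` that does not overshoot `x` is `min_l (x_l - v_l)`. With these
coefficients, coordinate `l` is reached exactly when some `v` attains its minimum at `l`. -/
lemma mem_tconv_iff_covector {V : Finset (Fin d → WithBot ℝ)}
    (hV : ∀ v ∈ V, v ∈ tropNat d) (hfin : ∀ v ∈ V, ∀ j, v j ≠ ⊥) (x : Fin d → ℝ) :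
    toTrop x ∈ tconv V ↔ ∀ l, ∃ v, (v, l) ∈ covector V x := by
  have hw : ∀ v, ∃ w : Fin (d + 1) → ℤ, v ∈ V → ∀ l, homog v l = ((w l : ℝ) : WithBot ℝ) := by
    intro v
    by_cases hv : v ∈ V
    · obtain ⟨w, hw⟩ := exists_int_homog (hV v hv) (hfin v hv)
      exact ⟨w, fun _ => hw⟩
    · exact ⟨0, fun h => absurd h hv⟩
  choose w hw using hw
  rw [mem_tconv_iff_homog]
  constructor
  · rintro ⟨c, hc⟩ l
    have hne : V.Nonempty := by
      by_contra h
      rw [Finset.not_nonempty_iff_eq_empty] at h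
      have := hc l
      rw [homog_toTrop, h, Finset.sup_empty] at this
      exact WithBot.coe_ne_bot this
    obtain ⟨v, hv, hsup⟩ := Finset.exists_mem_eq_sup V hne fun v => c v + homog v l
    rw [← hc l, homog_toTrop, hw v hv] at hsup
    have hcv : c v ≠ ⊥ := fun h => by
      rw [h, WithBot.bot_add] at hsup
      exact WithBot.coe_ne_bot hsup
    obtain ⟨r, hr⟩ := WithBot.ne_bot_iff_exists.1 hcv
    rw [← hr, ← WithBot.coe_add, WithBot.coe_inj] at hsup
    refine ⟨v, (mem_covector_iff hv (hw v hv) x l).2 fun l' => ?_⟩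
    have h1 : c v + homog v l' ≤ homog (toTrop x) l' :=
      (Finset.le_sup (f := fun v => c v + homog v l') hv).trans_eq (hc l').symm
    rw [homog_toTrop, hw v hv, ← hr, ← WithBot.coe_add, WithBot.coe_le_coe] at h1
    push_cast
    linarith
  · intro h
    refine ⟨fun v => ((Finset.univ.inf' Finset.univ_nonempty
      fun l => realHomog x l - w v l : ℝ) : WithBot ℝ), fun l => le_antisymm ?_ ?_⟩
    · obtain ⟨v, hvl⟩ := h l
      have hv : v ∈ V := hvl.1
      refine le_trans ?_ (Finset.le_sup hv)
      rw [homog_toTrop, hw v hv, ← WithBot.coe_add, WithBot.coe_le_coe, ← sub_le_iff_le_add]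
      refine Finset.le_inf' _ _ fun l' _ => ?_
      have := (mem_covector_iff hv (hw v hv) x l).1 hvl l'
      push_cast at this
      linarith
    · refine Finset.sup_le fun v hv => ?_
      rw [homog_toTrop, hw v hv, ← WithBot.coe_add, WithBot.coe_le_coe, ← le_sub_iff_add_le]
      exact Finset.inf'_le _ (Finset.mem_univ l)

/-- The points of a tropical polytope with finite generators are finite, and lie between a generator
and the coordinatewise maximum of the generators. -/
lemma exists_eq_toTrop_of_mem_tconv {V : Finset (Fin d → WithBot ℝ)}
    (hfin : ∀ v ∈ V, ∀ j, v j ≠ ⊥) {y : Fin d → WithBot ℝ} (hy : y ∈ tconv V) :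
    ∃ x, y = toTrop x ∧ (∃ v ∈ V, v ≤ y) ∧ ∀ j, ∃ v ∈ V, y j ≤ v j := by
  obtain ⟨c, hc, hcy⟩ := hy
  have hne : V.Nonempty := by
    by_contra h
    rw [Finset.not_nonempty_iff_eq_empty] at h
    rw [h, Finset.sup_empty] at hc
    exact WithBot.coe_ne_bot hc.symm
  obtain ⟨v₀, hv₀, hc₀⟩ := Finset.exists_mem_eq_sup V hne c
  have hle : v₀ ≤ y := fun j => by
    rw [hcy j]
    refine le_trans ?_ (Finset.le_sup hv₀)
    rw [← hc₀, hc, zero_add]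
  have hb : ∀ j, ∃ r : ℝ, (r : WithBot ℝ) = y j := fun j =>
    WithBot.ne_bot_iff_exists.1 fun h => hfin v₀ hv₀ j (le_bot_iff.1 (h ▸ hle j))
  choose x hx using hb
  refine ⟨x, funext fun j => (hx j).symm, ⟨v₀, hv₀, hle⟩, fun j => ?_⟩
  obtain ⟨v, hv, hsup⟩ := Finset.exists_mem_eq_sup V hne fun v => c v + v j
  refine ⟨v, hv, ?_⟩
  rw [hcy j, hsup]
  have : c v ≤ 0 := hc ▸ Finset.le_sup hv
  calc c v + v j ≤ 0 + v j := by gcongr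
    _ = v j := zero_add _

/-- Covectors are constant on alcove classes and decide membership, so a simplex inside a cell lies
in the polytope. Disjointness and covering then follow from having equivalence classes. -/
lemma mem_alcovedTriangulation_iff {V : Finset (Fin d → WithBot ℝ)}
    (hV : ∀ v ∈ V, v ∈ tropNat d) (hfin : ∀ v ∈ V, ∀ j, v j ≠ ⊥) (σ : Set (Fin d → ℝ)) :
    σ ∈ alcovedTriangulation V ↔ ∃ x, toTrop x ∈ tconv V ∧ σ = alcoveClass x := by
  constructor
  · rintro ⟨⟨z, hz⟩, ⟨π, s, a, hs, rfl⟩, F, ⟨x, hx, rfl⟩, hF⟩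
    refine ⟨z, ?_, alcove_eq_alcoveClass hs hz⟩
    have hcov : covector V z = covector V x := hF hz
    rw [mem_tconv_iff_covector hV hfin] at hx ⊢
    rwa [hcov]
  · rintro ⟨x, hx, rfl⟩
    obtain ⟨π, s, hs, hmem⟩ := exists_mem_alcove_floor x
    exact ⟨⟨x, self_mem_alcoveClass x⟩, ⟨π, s, _, hs, (alcove_eq_alcoveClass hs hmem).symm⟩,
      _, ⟨x, hx, rfl⟩, fun y hy => covector_eq_of_mem_alcoveClass hV hfin hy⟩

end TropEhr

/-! ## The tropical Ehrhart polynomial -/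

namespace TropEhr

open Polynomial

variable {d : ℕ}

instance : Finite RelSymbol :=
  Finite.of_surjective ![RelSymbol.eq, RelSymbol.le, RelSymbol.lt]
    (by rintro (_ | _ | _); exacts [⟨0, rfl⟩, ⟨1, rfl⟩, ⟨2, rfl⟩])

/-- The simplices of the alcoved triangulation can be written with `a` in a fixed box. -/
lemma exists_bounded_representation {V : Finset (Fin d → WithBot ℝ)}
    (hV : ∀ v ∈ V, v ∈ tropNat d) (hfin : ∀ v ∈ V, ∀ j, v j ≠ ⊥) :
    ∃ M : Fin d → ℤ, ∀ σ ∈ alcovedTriangulation V,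
      ∃ π s a, 0 ≤ a ∧ a ≤ M ∧ IsRelOpenAlcove σ π s a := by
  have hn : ∀ v, ∃ n : Fin d → ℕ, v ∈ V → ∀ j, v j = ((n j : ℝ) : WithBot ℝ) := by
    intro v
    by_cases hv : v ∈ V
    · choose n hn using fun j => (hV v hv j).resolve_left (hfin v hv j)
      exact ⟨n, fun _ => hn⟩
    · exact ⟨0, fun h => absurd h hv⟩
  choose n hn using hn
  refine ⟨fun j => ((V.sup fun v => n v j : ℕ) : ℤ), fun σ hσ => ?_⟩
  obtain ⟨x, hx, rfl⟩ := (mem_alcovedTriangulation_iff hV hfin σ).1 hσ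
  obtain ⟨π, s, hs, hmem⟩ := exists_mem_alcove_floor x
  obtain ⟨-, -, ⟨v, hv, hle⟩, hub⟩ := exists_eq_toTrop_of_mem_tconv hfin hx
  refine ⟨π, s, _, fun j => ?_, fun j => ?_, hs, (alcove_eq_alcoveClass hs hmem).symm⟩
  · have h1 := hle j
    rw [hn v hv, toTrop, WithBot.coe_le_coe] at h1
    exact Int.floor_nonneg.2 ((Nat.cast_nonneg _).trans h1)
  · obtain ⟨u, hu, h1⟩ := hub j
    rw [hn u hu, toTrop, WithBot.coe_le_coe] at h1
    have h2 : n u j ≤ V.sup fun v => n v j := Finset.le_sup (f := fun v => n v j) hu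
    have h3 : x j ≤ ((V.sup fun v => n v j : ℕ) : ℝ) := h1.trans (by exact_mod_cast h2)
    have h4 : ((⌊x j⌋ : ℤ) : ℝ) ≤ (((V.sup fun v => n v j : ℕ) : ℤ) : ℝ) := by
      rw [Int.cast_natCast]
      exact (Int.floor_le _).trans h3
    exact_mod_cast h4

lemma finite_alcovedTriangulation {V : Finset (Fin d → WithBot ℝ)}
    (hV : ∀ v ∈ V, v ∈ tropNat d) (hfin : ∀ v ∈ V, ∀ j, v j ≠ ⊥) :
    (alcovedTriangulation V).Finite := by
  obtain ⟨M, hM⟩ := exists_bounded_representation hV hfin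
  refine (((Set.finite_univ (α := Equiv.Perm (Fin d))).prod
    ((Set.finite_univ (α := Fin (d + 1) → RelSymbol)).prod (Set.finite_Icc 0 M))).image
      fun q => alcove q.1 q.2.1 q.2.2).subset fun σ hσ => ?_
  obtain ⟨π, s, a, h0, h1, -, rfl⟩ := hM σ hσ
  exact ⟨(π, s, a), ⟨trivial, trivial, h0, h1⟩, rfl⟩

lemma coe_eq_tropLog_iff {b : ℕ} (hb : 2 ≤ b) (r : ℝ) (n : ℕ) :
    (r : WithBot ℝ) = tropLog b n ↔ (b : ℝ) ^ r = n := by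
  have hb1 : (1 : ℝ) < b := by exact_mod_cast hb
  have hb0 : (0 : ℝ) < b := by linarith
  rw [tropLog]
  split_ifs with h
  · subst h
    -- For `n = 0` both sides fail: a real number is not `-∞`, and a power of `b` is positive.
    simpa using (Real.rpow_pos_of_pos hb0 r).ne'
  · have hn : (0 : ℝ) < n := by exact_mod_cast Nat.pos_of_ne_zero h
    rw [WithBot.coe_inj, eq_comm, Real.logb_eq_iff_rpow_eq hb0 hb1.ne' hn]

lemma tropDilate_inter_tropLattice {b : ℕ} (hb : 2 ≤ b) {V : Finset (Fin d → WithBot ℝ)}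
    (hV : ∀ v ∈ V, v ∈ tropNat d) (hfin : ∀ v ∈ V, ∀ j, v j ≠ ⊥) (k : ℕ) :
    tropDilate k (tconv V) ∩ tropLattice b d =
      (fun x => toTrop fun j => (k : ℝ) + x j) '' ⋃ σ ∈ alcovedTriangulation V, tropPoints b k σ := by
  ext y
  simp only [Set.mem_image, Set.mem_iUnion, exists_prop]
  constructor
  · rintro ⟨⟨z, hz, rfl⟩, hlat⟩
    obtain ⟨x, rfl, -⟩ := exists_eq_toTrop_of_mem_tconv hfin hz
    refine ⟨x, ⟨alcoveClass x, (mem_alcovedTriangulation_iff hV hfin _).2 ⟨x, hz, rfl⟩,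
      self_mem_alcoveClass x, fun j => ?_⟩, rfl⟩
    obtain ⟨n, hn⟩ := hlat j
    exact ⟨n, (coe_eq_tropLog_iff hb _ n).1 hn⟩
  · rintro ⟨x, ⟨σ, hσ, hxσ, hx⟩, rfl⟩
    refine ⟨⟨toTrop x, ?_, rfl⟩, fun j => ?_⟩
    · obtain ⟨z, hz, rfl⟩ := (mem_alcovedTriangulation_iff hV hfin _).1 hσ
      rw [mem_tconv_iff_covector hV hfin] at hz ⊢
      rwa [covector_eq_of_mem_alcoveClass hV hfin hxσ]
    · obtain ⟨n, hn⟩ := hx j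
      exact ⟨n, (coe_eq_tropLog_iff hb _ n).2 hn⟩

lemma pairwiseDisjoint_alcovedTriangulation {V : Finset (Fin d → WithBot ℝ)}
    (hV : ∀ v ∈ V, v ∈ tropNat d) (hfin : ∀ v ∈ V, ∀ j, v j ≠ ⊥) (b k : ℕ) :
    (alcovedTriangulation V).PairwiseDisjoint (tropPoints b k) := by
  intro σ hσ τ hτ hne
  obtain ⟨x, -, rfl⟩ := (mem_alcovedTriangulation_iff hV hfin _).1 hσ
  obtain ⟨y, -, rfl⟩ := (mem_alcovedTriangulation_iff hV hfin _).1 hτ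
  refine Set.disjoint_left.2 fun z hz hz' => hne ?_
  rw [← alcoveClass_eq_of_mem hz.1, ← alcoveClass_eq_of_mem hz'.1]

/-! ### Uniqueness of Ehrhart polynomials, from their values at infinitely many arguments. -/

lemma ehrhartCoeff_eq {Q : Set (Fin d → ℝ)} {p : ℝ[X]} (hp : IsEhrhartPolynomial Q p) (i : ℕ) :
    ehrhartCoeff Q i = p.coeff i := by
  have h : ∃ p, IsEhrhartPolynomial Q p := ⟨p, hp⟩
  rw [ehrhartCoeff, dif_pos h]
  congr 1
  refine eq_of_infinite_eval_eq _ _ (Set.Infinite.mono ?_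
    (Set.infinite_range_of_injective (f := fun n : ℕ => ((n + 1 : ℕ) : ℝ))
      fun m n hmn => by simpa using hmn))
  rintro _ ⟨n, rfl⟩
  exact ((h.choose_spec (n + 1) n.succ_pos).2).symm.trans (hp (n + 1) n.succ_pos).2

lemma tropEhrhartCoeff_eq {b : ℕ} (hb : 2 ≤ b) {P : Set (Fin d → WithBot ℝ)} {p : ℝ[X]}
    (hp : IsTropEhrhartPolynomial b P p) (i : ℕ) : tropEhrhartCoeff b P i = p.coeff i := by
  have h : ∃ p, IsTropEhrhartPolynomial b P p := ⟨p, hp⟩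
  rw [tropEhrhartCoeff, dif_pos h]
  congr 1
  have hb1 : (1 : ℝ) < b := by exact_mod_cast hb
  refine eq_of_infinite_eval_eq _ _ (Set.Infinite.mono ?_
    (Set.infinite_range_of_injective (f := fun n : ℕ => (b : ℝ) ^ n)
      (pow_right_strictMono₀ hb1).injective))
  rintro _ ⟨n, rfl⟩
  exact ((h.choose_spec.2 n).2).symm.trans (hp.2 n).2

lemma affDim_le (σ : Set (Fin d → ℝ)) : affDim σ ≤ d :=
  (Submodule.finrank_le _).trans (by simp)

/-- The tropical Ehrhart polynomial in terms of classical Ehrhart polynomials of simplices. -/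
theorem exists_tropEhrhartPolynomial {b : ℕ} (hb : 2 ≤ b) {V : Finset (Fin d → WithBot ℝ)}
    (hV : ∀ v ∈ V, v ∈ tropNat d) (hfin : ∀ v ∈ V, ∀ j, v j ≠ ⊥)
    (π : Set (Fin d → ℝ) → Equiv.Perm (Fin d)) (s : Set (Fin d → ℝ) → Fin (d + 1) → RelSymbol)
    (a : Set (Fin d → ℝ) → Fin d → ℤ)
    (hrep : ∀ σ ∈ alcovedTriangulation V, 0 ≤ a σ ∧ IsRelOpenAlcove σ (π σ) (s σ) (a σ)) :
    ∃ P : ℝ[X], IsTropEhrhartPolynomial b (tconv V) P ∧ ∀ i, P.coeff i =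
      ∑ᶠ σ ∈ {σ ∈ alcovedTriangulation V | i ≤ affDim σ},
        (-1 : ℝ) ^ (affDim σ - i) * ((b : ℝ) - 1) ^ i *
          ehrhartCoeff (diagImage b (a σ) (closure (alcove0 (π σ) (s σ)))) i := by
  classical
  have hT := finite_alcovedTriangulation hV hfin
  have hp : ∀ σ, ∃ p : ℝ[X], σ ∈ alcovedTriangulation V →
      IsEhrhartPolynomial (diagImage b (a σ) (closure (alcove0 (π σ) (s σ)))) p ∧
      p.natDegree ≤ affDim σ ∧ ∀ k : ℕ, (tropPoints b k σ).Finite ∧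
        ((tropPoints b k σ).ncard : ℝ) =
          (-1) ^ affDim σ * p.eval (-((b - 1) * (b : ℝ) ^ k)) := by
    intro σ
    by_cases hσ : σ ∈ alcovedTriangulation V
    · obtain ⟨ha, hs, h⟩ := hrep σ hσ
      obtain ⟨p, hp⟩ := exists_ehrhart_polynomial_alcove hb hs (h ▸ hσ.1) ha
      rw [← h] at hp
      exact ⟨p, fun _ => hp⟩
    · exact ⟨0, fun h => absurd h hσ⟩
  choose p hp using hp
  -- The summand of `σ` is `(-1)^m p_σ(-(b-1) X)`, to be evaluated at `b^k`.
  refine ⟨∑ σ ∈ hT.toFinset, C ((-1 : ℝ) ^ affDim σ) * (p σ).comp (C (-((b : ℝ) - 1)) * X),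
    ⟨?_, fun k => ?_⟩, fun i => ?_⟩
  · refine natDegree_sum_le_of_forall_le _ _ fun σ hσ => ?_
    have hσ' := hp σ (hT.mem_toFinset.1 hσ)
    refine (natDegree_C_mul_le _ _).trans (natDegree_comp_le.trans ?_)
    calc (p σ).natDegree * (C (-((b : ℝ) - 1)) * X).natDegree ≤ (p σ).natDegree * 1 :=
          Nat.mul_le_mul_left _ ((natDegree_C_mul_le _ _).trans natDegree_X_le)
      _ ≤ d := by rw [mul_one]; exact hσ'.2.1.trans (affDim_le σ)
  · have hinj : Function.Injective fun (x : Fin d → ℝ) => toTrop fun j => (k : ℝ) + x j := by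
      intro x y hxy
      funext j
      exact add_left_cancel (WithBot.coe_inj.1 (congrFun hxy j))
    have hf : ∀ σ ∈ alcovedTriangulation V, (tropPoints b k σ).Finite :=
      fun σ hσ => ((hp σ hσ).2.2 k).1
    rw [tropDilate_inter_tropLattice hb hV hfin k]
    refine ⟨(hT.biUnion hf).image _, ?_⟩
    rw [Set.ncard_image_of_injective _ hinj,
      hT.ncard_biUnion hf (pairwiseDisjoint_alcovedTriangulation hV hfin b k),
      finsum_mem_eq_finite_toFinset_sum _ hT, eval_finsetSum, Nat.cast_sum]
    refine Finset.sum_congr rfl fun σ hσ => ?_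
    rw [((hp σ (hT.mem_toFinset.1 hσ)).2.2 k).2]
    simp only [eval_mul, eval_C, eval_comp, eval_X, neg_mul]
  · have hset : {σ ∈ alcovedTriangulation V | i ≤ affDim σ} =
        ((hT.toFinset.filter fun σ => i ≤ affDim σ : Finset _) : Set (Set (Fin d → ℝ))) := by
      ext σ; simp
    rw [hset, finsum_mem_coe_finset, Finset.sum_filter, finsetSum_coeff]
    refine Finset.sum_congr rfl fun σ hσ => ?_
    obtain ⟨h1, h2, -⟩ := hp σ (hT.mem_toFinset.1 hσ)
    rw [coeff_C_mul, comp_C_mul_X_coeff]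
    split_ifs with hi
    · rw [ehrhartCoeff_eq h1, neg_pow ((b : ℝ) - 1) i]
      obtain ⟨m, hm⟩ := Nat.exists_eq_add_of_le hi
      rw [hm, Nat.add_sub_cancel_left, pow_add]
      have : (-1 : ℝ) ^ i * (-1) ^ i = 1 := by rw [← mul_pow]; simp
      linear_combination ((-1) ^ m * (p σ).coeff i * ((b : ℝ) - 1) ^ i) * this
    -- Simplices of dimension below `i` contribute nothing, since the degree of `p_σ` is at most the
    -- dimension of `σ`.
    · rw [coeff_eq_zero_of_natDegree_lt (by omega)]
      simp

end TropEhr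

theorem mainTheorem2 (d b : ℕ) (hb : 2 ≤ b)
    (V : Finset (Fin d → WithBot ℝ))
    (hV : ∀ v ∈ V, v ∈ TropEhr.tropNat d)
    (hfin : ∀ v ∈ V, ∀ j, v j ≠ ⊥) :
    -- the tropical Ehrhart polynomial exists
    (∃ p, TropEhr.IsTropEhrhartPolynomial b (TropEhr.tconv V) p) ∧
    -- the alcoved triangulation is finite, and its simplices can be indexed by `a ≥ 0`
    (TropEhr.alcovedTriangulation V).Finite ∧
    (∀ σ ∈ TropEhr.alcovedTriangulation V,
      ∃ π s a, 0 ≤ a ∧ TropEhr.IsRelOpenAlcove σ π s a) ∧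
    -- the classical Ehrhart polynomials in question exist
    (∀ σ ∈ TropEhr.alcovedTriangulation V, ∀ π s a, 0 ≤ a → TropEhr.IsRelOpenAlcove σ π s a →
      ∃ p, TropEhr.IsEhrhartPolynomial
        (TropEhr.diagImage b a (closure (TropEhr.alcove0 π s))) p) ∧
    -- the formula, for every way of writing the simplices `σ` as `Δ_π^s(a)` with `a ≥ 0`
    ∀ (π : Set (Fin d → ℝ) → Equiv.Perm (Fin d))
      (s : Set (Fin d → ℝ) → Fin (d + 1) → TropEhr.RelSymbol)
      (a : Set (Fin d → ℝ) → Fin d → ℤ),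
      (∀ σ ∈ TropEhr.alcovedTriangulation V,
        0 ≤ a σ ∧ TropEhr.IsRelOpenAlcove σ (π σ) (s σ) (a σ)) →
      ∀ i : ℕ, i ≤ d →
        TropEhr.tropEhrhartCoeff b (TropEhr.tconv V) i =
          ∑ᶠ σ ∈ {σ ∈ TropEhr.alcovedTriangulation V | i ≤ TropEhr.affDim σ},
            (-1 : ℝ) ^ (TropEhr.affDim σ - i) * ((b : ℝ) - 1) ^ i *
              TropEhr.ehrhartCoeff
                (TropEhr.diagImage b (a σ) (closure (TropEhr.alcove0 (π σ) (s σ)))) i := by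
  have hrep : ∀ σ ∈ TropEhr.alcovedTriangulation V,
      ∃ π s a, 0 ≤ a ∧ TropEhr.IsRelOpenAlcove σ π s a := by
    obtain ⟨M, hM⟩ := TropEhr.exists_bounded_representation hV hfin
    intro σ hσ
    obtain ⟨π, s, a, h0, -, h⟩ := hM σ hσ
    exact ⟨π, s, a, h0, h⟩
  refine ⟨?_, TropEhr.finite_alcovedTriangulation hV hfin, hrep, ?_, ?_⟩
  · have hrep' : ∀ σ, ∃ π s a, σ ∈ TropEhr.alcovedTriangulation V →
        0 ≤ a ∧ TropEhr.IsRelOpenAlcove σ π s a := by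
      intro σ
      by_cases hσ : σ ∈ TropEhr.alcovedTriangulation V
      · obtain ⟨π, s, a, h⟩ := hrep σ hσ
        exact ⟨π, s, a, fun _ => h⟩
      -- Arbitrary values off the triangulation, so that representations can be chosen for all sets.
      · exact ⟨1, fun _ => .lt, 0, fun h => absurd h hσ⟩
    choose π s a h using hrep'
    obtain ⟨P, hP, -⟩ := TropEhr.exists_tropEhrhartPolynomial hb hV hfin π s a h
    exact ⟨P, hP⟩
  · rintro σ hσ π s a ha ⟨hs, rfl⟩
    obtain ⟨p, hp, -⟩ := TropEhr.exists_ehrhart_polynomial_alcove hb hs hσ.1 ha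
    exact ⟨p, hp⟩
  · intro π s a h i _
    obtain ⟨P, hP, hcoeff⟩ := TropEhr.exists_tropEhrhartPolynomial hb hV hfin π s a h
    rw [TropEhr.tropEhrhartCoeff_eq hb hP, hcoeff]
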